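/- **Setting.** Let $S=\mathbb P_1\setminus\{0,1,\infty\}$ and let $\mathcal L\to S$ be the Legendre elliptic scheme, with fibre $\mathcal L_\lambda:\ y^2=x(x-1)(x-\lambda)$. For $\lambda\in S$ let $\Lambda_\lambda\subset\mathbb C$ be the period lattice of $\mathcal L_\lambda$ with respect to $dx/y$, so that $\mathcal L_\lambda\cong\mathbb C/\Lambda_\lambda$. Let $B$ be a connected smooth complex curve (Riemann surface) and $p:B\to S$ a finite (proper holomorphic, with finite fibres), possibly ramified, morphism whose branch locus $R\subset S$ (the image of the zeros of $dp$) is finite. Let $\mathcal E\to B$ be the pullback of $\mathcal L\to S$ by $p$, so that $\mathcal E_x$ has period lattice $\Lambda_{p(x)}$. Fix $b\in B$ with $s:=p(b)\notin R$, and let $$\rho_B:\pi_1(B,b)\to\mathrm{Aut}(\Lambda_{p(b)})\cong\mathrm{GL}_2(\mathbb Z)$$ be the monodromy representation on periods, given by analytic continuation of the locally defined holomorphic period functions along loops. Let $\mathfrak a_0,\mathfrak a_1,\mathfrak d_r\ (r\in R)$ be generators of $\pi_1(S\setminus R,s)$, where $\mathfrak a_0$, $\mathfrak a_1$, $\mathfrak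 d_r$ are classes of small loops around $0$, $1$, $r$ respectively, that is, of loops that travel along a path from $s$ to a point near the point in question, once counterclockwise along a small circle centred at it, and back along the same path. Put $$X^{(0)}=\{\mathfrak d_r: r\in R\},\qquad D^{(0)}=\langle X^{(0)}\rangle,$$ and for $n\ge 1$ $$X^{(n)}=\{\mathfrak a\mathfrak d\mathfrak a^{-1}\mathfrak d^{-1}:\ \mathfrak a\in\{\mathfrak a_0,\mathfrak a_0^{-1},\mathfrak a_1,\mathfrak a_1^{-1}\},\ \mathfrak d\in D^{(n-1)}\},\qquad D^{(n)}=\Big\langle\bigcup_{i=0}^n X^{(i)}\Big\rangle,$$ where $\langle Y\rangle$ is the subgroup generated by $Y$. Let $K=\big\langle\bigcup_{n\in\mathbb N}D^{(n)}\big\rangle$. Let $$p_*:\pi_1(B\setminus p^{-1}(R),b)\to\pi_1(S\setminus R,s),\qquad j_*:\pi_1(B\setminus p^{-1}(R),b)\to\pi_1(B,b)$$ be induced by $p$ and by the inclusion $j$. **Theorem.** The representation $\rho_B$ exists and is uniquely determined by the above description, and $\ker\rho_B=p_*^{-1}(K)$ in the following sense: $$j_*^{-1}(\ker\rho_B)=p_*^{-1}(K)\qquad\text{and}\qquad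 \ker\rho_B=j_*\big(p_*^{-1}(K)\big).$$ -/

import Mathlib

open scoped Manifold ContDiff Topology unitInterval

noncomputable section

/-! ### The Legendre family and its periods -/

/-- The base `S = ℙ¹ ∖ {0, 1, ∞}` of the Legendre family, as an open subset of `ℂ`. -/
def legendreBase : Set ℂ := {z | z ≠ 0 ∧ z ≠ 1}

/-- The Legendre curve `y² = x (x - 1) (x - l) = x³ - (1 + l) x² + l x`. -/
def legendreCurve (l : ℂ) : WeierstrassCurve ℂ := ⟨0, -(1 + l), 0, l, 0⟩

/-- The lattice of `L` uniformizes the Legendre curve with parameter `l`, compatibly with the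
differential `dx / y`: the map `z ↦ (x, y) = (4 ℘(z) + (1 + l) / 3, 4 ℘'(z))` sends `ℂ ∖ Λ` to the
affine curve, and so identifies `ℂ / Λ` with the elliptic curve. As `y = dx / dz`, the invariant
differential `dx / y` corresponds to `dz`, and `Λ` is its lattice of periods. -/
def UniformizesLegendre (L : PeriodPair) (l : ℂ) : Prop :=
  ∀ z : ℂ, z ∉ L.lattice →
    (legendreCurve l).toAffine.Equation
      (4 * L.weierstrassP z + (1 + l) / 3) (4 * L.derivWeierstrassP z)

/-- The period lattice `Λ_l` of the Legendre curve with parameter `l`, with respect to `dx / y`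
(for `l ≠ 0, 1` exactly one lattice uniformizes the curve, so that the supremum is this lattice). -/
def periodLattice (l : ℂ) : Submodule ℤ ℂ :=
  ⨆ (L : PeriodPair) (_ : UniformizesLegendre L l), L.lattice

/-! ### Monodromy of the periods of the pullback of the Legendre family along `p : B → S` -/

section Monodromy

variable {B : Type*} [TopologicalSpace B] [ChartedSpace ℂ B]

/-- Analytic continuation of a period function along the path `γ` in `B`. Here the fibre over `x` of
the elliptic scheme is the Legendre curve with parameter `p x`, so its period lattice is
`periodLattice (p x)`. The function `f t` represents the germ at `γ t`; it is holomorphic near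
`γ t` with periods as values, and the germs belonging to nearby parameters are compatible. -/
def IsPeriodContinuation (p : B → legendreBase) {b c : B} (γ : Path b c) (f : I → B → ℂ) : Prop :=
  ∀ t : I,
    (∀ᶠ x in 𝓝 (γ t), MDifferentiableAt 𝓘(ℂ) 𝓘(ℂ) (f t) x ∧ f t x ∈ periodLattice (p x)) ∧
    ∀ᶠ u in 𝓝 t, f u =ᶠ[𝓝 (γ u)] f t

/-- `ρ` is the monodromy representation of `π₁(B, b)` on the period lattice of the fibre over `b`:
every period `w` of this fibre extends to a period function near `b` that continues analytically
along every loop `γ` at `b`, with final value `ρ [γ] w`. (In the multiplication of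
`FundamentalGroup` the right factor is travelled first, as in the composition of
automorphisms.) -/
def IsPeriodMonodromy (p : B → legendreBase) (b : B)
    (ρ : FundamentalGroup B b →* (periodLattice (p b) ≃ₗ[ℤ] periodLattice (p b))) : Prop :=
  ∀ (γ : Path b b) (w : periodLattice (p b)),
    ∃ f : I → B → ℂ, IsPeriodContinuation p γ f ∧ f 0 b = w ∧
      f 1 b = ρ (FundamentalGroup.fromPath (Path.Homotopic.Quotient.mk γ)) w

/-! ### Branch locus, and the restriction of `p` to its complement -/

/-- The branch locus of `p`: the images of the points at which the differential of `p` vanishes. -/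
def branchLocus (p : B → legendreBase) : Set ℂ :=
  {r | ∃ x : B, mfderiv 𝓘(ℂ) 𝓘(ℂ) (fun y => (p y : ℂ)) x = 0 ∧ (p x : ℂ) = r}

/-- `S ∖ R`, where `R` is the branch locus of `p`. -/
def puncturedBase (p : B → legendreBase) : Set ℂ := legendreBase \ branchLocus p

/-- `B ∖ p⁻¹(R)`, where `R` is the branch locus of `p`. -/
def puncturedSource (p : B → legendreBase) : Set B := {x | (p x : ℂ) ∉ branchLocus p}

/-- The map `B ∖ p⁻¹(R) → S ∖ R` induced by `p`. -/
def puncturedMap (p : B → legendreBase) (hp : Continuous p) :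
    C(puncturedSource p, puncturedBase p) where
  toFun x := ⟨(p x : ℂ), (p x).2, x.2⟩
  continuous_toFun := by fun_prop

/-- The inclusion `B ∖ p⁻¹(R) → B`. -/
def puncturedInclusion (p : B → legendreBase) : C(puncturedSource p, B) where
  toFun x := x
  continuous_toFun := by fun_prop

end Monodromy

/-! ### Small loops and iterated commutators -/

/-- `g` is the class in `π₁(Ω, s)` of a small loop around `q`: travel along a path in `Ω` from `s` to
a point at distance `ε` from `q`, once counterclockwise along the circle of radius `ε` centred at
`q`, and back along the same path; the closed disc of radius `ε` around `q` is contained in `Ω`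
except possibly for its centre. -/
def IsSmallLoopAround {Ω : Set ℂ} {s : Ω} (q : ℂ) (g : FundamentalGroup Ω s) : Prop :=
  ∃ ε : ℝ, 0 < ε ∧ Metric.closedBall q ε \ {q} ⊆ Ω ∧
    ∃ (x : Ω) (β : Path s x) (c : Path x x),
      (∀ t : I, (c t : ℂ) = q + ε * Complex.exp (2 * Real.pi * Complex.I * (t : ℝ))) ∧
      g = FundamentalGroup.fromPath (Path.Homotopic.Quotient.mk ((β.trans c).trans β.symm))

section Commutators

variable {G : Type*} [Group G]

/-- The set `X⁽⁰⁾ ∪ ⋯ ∪ X⁽ⁿ⁾`, where `X⁽⁰⁾ = X` and `X⁽ⁿ⁺¹⁾` is the set of all commutators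
`a d a⁻¹ d⁻¹` with `a ∈ A` and `d ∈ D⁽ⁿ⁾ = ⟨X⁽⁰⁾ ∪ ⋯ ∪ X⁽ⁿ⁾⟩`. -/
def iteratedCommutators (A X : Set G) : ℕ → Set G
  | 0 => X
  | n + 1 => iteratedCommutators A X n ∪
      {g | ∃ a ∈ A, ∃ d ∈ Subgroup.closure (iteratedCommutators A X n), g = a * d * a⁻¹ * d⁻¹}

/-- The subgroup `D⁽ⁿ⁾ = ⟨X⁽⁰⁾ ∪ ⋯ ∪ X⁽ⁿ⁾⟩`. -/
def commutatorLayer (A X : Set G) (n : ℕ) : Subgroup G :=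
  Subgroup.closure (iteratedCommutators A X n)

/-- The subgroup `K` generated by all the `D⁽ⁿ⁾`. -/
def commutatorHull (A X : Set G) : Subgroup G :=
  Subgroup.closure (⋃ n : ℕ, (commutatorLayer A X n : Set G))

end Commutators

end

/-! ### The differential equation of `℘`, and injectivity of `(℘, ℘')` modulo the lattice -/

noncomputable section

namespace PeriodPair

open Filter Topology

variable (L M : PeriodPair)

/-! The modular function `λ` makes the upper half plane `ℍ` a covering of `S`, on which the periods
become single-valued. The period lattice over `λ(τ)` is `ω(τ)(ℤ + ℤτ)`, where `ω` is a holomorphic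
square root of `4(e₁ - e₂)` (`periodLattice_modularLambda`). The fibres of `λ` are the orbits of the
Sanov subgroup, a lift to `SL₂(ℤ)` of `Γ(2)/±1` that acts freely and properly discontinuously. `λ`
is onto `S`, because its image is open and relatively closed, so it is a covering
(`isQuotientCoveringMap_lambdaMap`).

A continuation of periods along a loop in `B` has constant integer coordinates in the basis `ω, ωτ`
along a lift to `ℍ` of the image loop in `S`. This gives existence and uniqueness of `ρ_B`. Since a
basis determines `τ` as its ratio, a loop acts trivially exactly when its lift closes up. Hence `ker
ρ_B` is the kernel of `π₁(B) → π₁(S) → Sanov^op` (`ker_periodMonodromy`), and a possible sign in the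
transformation law of `ω` plays no role.

It remains to find the kernel of `Θ : G = π₁(S ∖ R) → Sanov^op`. The map `Θ` is surjective, as paths
in `ℍ` can be moved off the countable set over `R`, and it kills the loops around points of `R`,
which bound discs in `S`. The iterated commutators make `K` stable under conjugation by generators,
so `K` is normal and `G/K` is generated by two elements. The Sanov subgroup is free of rank two
(ping-pong and Euclid's algorithm) and Hopfian (residual finiteness), so the composite surjection
`F₂ → G/K → Sanov` is injective and `ker Θ = K` (`ker_eq_commutatorHull`).

The first equality follows because both routes from `B ∖ p⁻¹(R)` to `S` agree. The second follows
from surjectivity of `j_*`, since loops on a surface can be moved off a finite set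
(`Path.avoids_of_countable`). -/

lemma countable_lattice : (L.lattice : Set ℂ).Countable := by
  have : Countable L.lattice := L.latticeEquivProd.toEquiv.countable_iff.mpr inferInstance
  exact Set.countable_coe_iff.mp this

lemma countable_preimage_add (a : ℂ) : {z : ℂ | z + a ∈ L.lattice}.Countable :=
  L.countable_lattice.preimage (add_left_injective a)

lemma isPreconnected_compl_lattices (a b : ℂ) :
    IsPreconnected ({z : ℂ | z + a ∈ L.lattice} ∪ {z : ℂ | z + b ∈ M.lattice})ᶜ :=
  (Set.Countable.isConnected_compl_of_one_lt_rank (by simp)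
    ((L.countable_preimage_add a).union (M.countable_preimage_add b))).isPreconnected

lemma eventually_add_notMem_lattice (a z : ℂ) : ∀ᶠ w in 𝓝[≠] z, w + a ∉ L.lattice := by
  have h := L.compl_lattice_sdiff_singleton_mem_nhds (z + a)
  have h2 : Tendsto (fun w : ℂ => w + a) (𝓝 z) (𝓝 (z + a)) := by
    apply Continuous.tendsto; fun_prop
  filter_upwards [self_mem_nhdsWithin, mem_nhdsWithin_of_mem_nhds (h2 h)] with w hw hw'
  intro hmem
  exact hw' ⟨hmem, fun h => hw (add_right_cancel h)⟩

lemma isOpen_compl_lattice_add (a : ℂ) : IsOpen {z : ℂ | z + a ∉ L.lattice} :=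
  L.isClosed_lattice.isOpen_compl.preimage (by fun_prop : Continuous fun z : ℂ => z + a)

lemma analyticAt_weierstrassP {z : ℂ} (hz : z ∉ L.lattice) : AnalyticAt ℂ L.weierstrassP z :=
  L.analyticOnNhd_weierstrassP z hz

lemma analyticAt_derivWeierstrassP {z : ℂ} (hz : z ∉ L.lattice) :
    AnalyticAt ℂ L.derivWeierstrassP z :=
  L.analyticOnNhd_derivWeierstrassP z hz

lemma analyticAt_weierstrassP_add (a : ℂ) {z : ℂ} (hz : z + a ∉ L.lattice) :
    AnalyticAt ℂ (fun w => L.weierstrassP (w + a)) z :=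
  AnalyticAt.fun_comp (g := L.weierstrassP) (L.analyticAt_weierstrassP hz) (by fun_prop)

lemma hasDerivAt_weierstrassP {z : ℂ} (hz : z ∉ L.lattice) :
    HasDerivAt L.weierstrassP (L.derivWeierstrassP z) z := by
  rw [← L.deriv_weierstrassP]
  exact (L.analyticAt_weierstrassP hz).differentiableAt.hasDerivAt

lemma tendsto_weierstrassP_cobounded {l : ℂ} (hl : l ∈ L.lattice) :
    Tendsto L.weierstrassP (𝓝[≠] l) (Bornology.cobounded ℂ) := by
  have h : meromorphicOrderAt (𝕜 := ℂ) L.weierstrassP l < 0 := by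
    rw [L.order_weierstrassP l hl]
    exact (by decide : (-2 : WithTop ℤ) < 0)
  exact tendsto_cobounded_of_meromorphicOrderAt_neg h

/-- If translates of two `℘`-functions agree near a point, then the poles of one are poles of the
other. -/
lemma add_mem_lattice_of_eventuallyEq {a b z₀ : ℂ} (ha : z₀ + a ∉ L.lattice)
    (hb : z₀ + b ∉ M.lattice)
    (h : ∀ᶠ z in 𝓝 z₀, L.weierstrassP (z + a) = M.weierstrassP (z + b)) {z : ℂ}
    (hz : z + a ∈ L.lattice) : z + b ∈ M.lattice := by
  by_contra hzb
  -- By the identity theorem the translates agree on the connected complement of both pole sets.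
  -- Near a pole of the first only, one side would tend to infinity while the other stays bounded.
  set U : Set ℂ := ({z : ℂ | z + a ∈ L.lattice} ∪ {z : ℂ | z + b ∈ M.lattice})ᶜ with hU
  have key : Set.EqOn (fun w => L.weierstrassP (w + a)) (fun w => M.weierstrassP (w + b)) U := by
    apply AnalyticOnNhd.eqOn_of_preconnected_of_eventuallyEq (𝕜 := ℂ) (z₀ := z₀)
    · intro w hw
      exact L.analyticAt_weierstrassP_add a (fun h => hw (Or.inl h))
    · intro w hw
      exact M.analyticAt_weierstrassP_add b (fun h => hw (Or.inr h))
    · exact isPreconnected_compl_lattices L M a b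
    · rintro (h | h)
      exacts [ha h, hb h]
    · exact h
  have hUz : ∀ᶠ w in 𝓝[≠] z, w ∈ U := by
    filter_upwards [L.eventually_add_notMem_lattice a z, M.eventually_add_notMem_lattice b z]
      with w h1 h2
    rintro (h | h)
    exacts [h1 h, h2 h]
  have hM : Tendsto (fun w => M.weierstrassP (w + b)) (𝓝[≠] z) (𝓝 (M.weierstrassP (z + b))) :=
    (M.analyticAt_weierstrassP_add b hzb).continuousAt.tendsto.mono_left nhdsWithin_le_nhds
  have hsh : Tendsto (fun w : ℂ => w + a) (𝓝[≠] z) (𝓝[≠] (z + a)) := by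
    apply tendsto_nhdsWithin_of_tendsto_nhds_of_eventually_within
    · exact ((by fun_prop : Continuous fun w : ℂ => w + a).tendsto z).mono_left nhdsWithin_le_nhds
    · filter_upwards [self_mem_nhdsWithin] with w hw h
      exact hw (add_right_cancel h)
  have hL : Tendsto (fun w => M.weierstrassP (w + b)) (𝓝[≠] z) (Bornology.cobounded ℂ) :=
    ((L.tendsto_weierstrassP_cobounded hz).comp hsh).congr' (by
      filter_upwards [hUz] with w hw using key hw)
  exact hM.not_tendsto (Metric.disjoint_nhds_cobounded _) hL

/-- `℘'' = 6 ℘² - g₂ / 2`. -/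
lemma hasDerivAt_derivWeierstrassP {z : ℂ} (hz : z ∉ L.lattice) :
    HasDerivAt L.derivWeierstrassP (6 * L.weierstrassP z ^ 2 - L.g₂ / 2) z := by
  have hd : ∀ w, w ∉ L.lattice → HasDerivAt L.derivWeierstrassP (deriv L.derivWeierstrassP w) w :=
    fun w hw => (L.analyticAt_derivWeierstrassP hw).differentiableAt.hasDerivAt
  have hop : IsOpen ((L.lattice : Set ℂ)ᶜ) := L.isClosed_lattice.isOpen_compl
  -- Differentiating `℘'² = 4℘³ - g₂℘ - g₃` gives the claim multiplied by `2℘'`.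
  have hmul : ∀ w, w ∉ L.lattice → L.derivWeierstrassP w *
      (deriv L.derivWeierstrassP w - (6 * L.weierstrassP w ^ 2 - L.g₂ / 2)) = 0 := by
    intro w hw
    have h1 : HasDerivAt (fun w => L.derivWeierstrassP w ^ 2)
        (2 * L.derivWeierstrassP w * deriv L.derivWeierstrassP w) w := by
      simpa using (hd w hw).fun_pow 2
    have h2 : HasDerivAt (fun w => 4 * L.weierstrassP w ^ 3 - L.g₂ * L.weierstrassP w - L.g₃)
        (4 * (3 * L.weierstrassP w ^ 2 * L.derivWeierstrassP w) - L.g₂ * L.derivWeierstrassP w)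
        w := by
      have h := L.hasDerivAt_weierstrassP hw
      simpa using (((h.fun_pow 3).const_mul 4).fun_sub (h.const_mul L.g₂)).sub_const L.g₃
    have h3 : (fun w => L.derivWeierstrassP w ^ 2) =ᶠ[𝓝 w]
        (fun w => 4 * L.weierstrassP w ^ 3 - L.g₂ * L.weierstrassP w - L.g₃) := by
      filter_upwards [hop.mem_nhds hw] with u hu using L.derivWeierstrassP_sq u hu
    have := h1.unique (h2.congr_of_eventuallyEq h3)
    linear_combination this / 2
  have hpre : IsPreconnected ((L.lattice : Set ℂ)ᶜ) := by
    simpa using isPreconnected_compl_lattices L L 0 0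
  -- `℘'` does not vanish near `z`, otherwise `℘` would be constant in spite of its pole at `0`. So
  -- the factor `℘'` can be cancelled at points arbitrarily close to `z`, and continuity does the
  -- rest.
  have hne : ∃ᶠ w in 𝓝[≠] z, L.derivWeierstrassP w ≠ 0 := by
    intro hcon
    have hcon' : ∀ᶠ w in 𝓝[≠] z, L.derivWeierstrassP w = 0 := hcon.mono fun w hw => not_not.mp hw
    have hz0 := L.analyticOnNhd_derivWeierstrassP.eqOn_zero_of_preconnected_of_frequently_eq_zero
      hpre hz hcon'.frequently
    have hconst : ∀ {x y : ℂ}, x ∉ L.lattice → y ∉ L.lattice →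
        L.weierstrassP x = L.weierstrassP y := fun hx hy => hop.is_const_of_deriv_eq_zero hpre
      (fun w hw => (L.hasDerivAt_weierstrassP hw).differentiableAt.differentiableWithinAt)
      (fun w hw => by rw [(L.hasDerivAt_weierstrassP hw).deriv]; exact hz0 hw) hx hy
    have h0 := L.tendsto_weierstrassP_cobounded (l := 0) (zero_mem _)
    have h1 : Tendsto L.weierstrassP (𝓝[≠] 0) (𝓝 (L.weierstrassP z)) := by
      apply tendsto_const_nhds.congr'
      filter_upwards [L.eventually_add_notMem_lattice 0 0] with w hw
      exact hconst hz (by simpa using hw)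
    exact h1.not_tendsto (Metric.disjoint_nhds_cobounded _) h0
  have hD : AnalyticAt ℂ
      (fun w => deriv L.derivWeierstrassP w - (6 * L.weierstrassP w ^ 2 - L.g₂ / 2)) z := by
    have h1 := L.analyticAt_weierstrassP hz
    have h2 := (L.analyticAt_derivWeierstrassP hz).deriv
    fun_prop
  have hDz : deriv L.derivWeierstrassP z - (6 * L.weierstrassP z ^ 2 - L.g₂ / 2) = 0 := by
    by_contra hnz
    have h4 : ∀ᶠ w in 𝓝[≠] z,
        deriv L.derivWeierstrassP w - (6 * L.weierstrassP w ^ 2 - L.g₂ / 2) ≠ 0 :=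
      (hD.continuousAt.eventually_ne hnz).filter_mono nhdsWithin_le_nhds
    have h5 : ∀ᶠ w in 𝓝[≠] z, w ∉ L.lattice := by
      simpa using L.eventually_add_notMem_lattice 0 z
    obtain ⟨w, hw1, hw2, hw3⟩ := (hne.and_eventually (h4.and h5)).exists
    exact (mul_ne_zero hw1 hw2) (hmul w hw3)
  have := hd z hz
  rwa [sub_eq_zero.mp hDz] at this

/-- An analytic solution of a linear equation `h'' = φ h` with `h(z) = h'(z) = 0` vanishes. -/
lemma _root_.AnalyticAt.eventually_eq_zero_of_deriv_deriv {h φ : ℂ → ℂ} {z : ℂ}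
    (hh : AnalyticAt ℂ h z) (hφ : AnalyticAt ℂ φ z) (h0 : h z = 0) (h1 : deriv h z = 0)
    (heq : ∀ᶠ w in 𝓝 z, deriv (deriv h) w = φ w * h w) : ∀ᶠ w in 𝓝 z, h w = 0 := by
  have e1 := hh.analyticOrderAt_deriv_add_one
  have e2 := hh.deriv.analyticOrderAt_deriv_add_one
  simp only [h0, h1, sub_zero] at e1 e2
  -- Each derivative lowers the order by one, so `ord h = ord φ + ord h + 2`, which is impossible
  -- for finite order.
  have e3 : analyticOrderAt (deriv (deriv h)) z = analyticOrderAt φ z + analyticOrderAt h z := by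
    rw [analyticOrderAt_congr heq, ← analyticOrderAt_mul hφ hh]
    rfl
  rw [← analyticOrderAt_eq_top]
  rw [show (fun x => h x) = h from rfl] at e1
  rw [show (fun x => deriv h x) = deriv h from rfl] at e2
  rw [e3] at e2
  rw [← e2] at e1
  by_contra hne
  obtain ⟨n, hn⟩ := ENat.ne_top_iff_exists.mp hne
  rw [← hn] at e1
  generalize analyticOrderAt φ z = m at e1
  cases m with
  | top => simp at e1
  | coe m => norm_cast at e1; omega

/-- The map `(℘, ℘')` is injective modulo the lattice. -/
lemma sub_mem_lattice_of_weierstrassP_eq {u v : ℂ} (hu : u ∉ L.lattice) (hv : v ∉ L.lattice)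
    (h0 : L.weierstrassP u = L.weierstrassP v)
    (h1 : L.derivWeierstrassP u = L.derivWeierstrassP v) : u - v ∈ L.lattice := by
  set h : ℂ → ℂ := fun z => L.weierstrassP (z + u) - L.weierstrassP (z + v) with hdef
  have hou : ∀ᶠ z in 𝓝 (0 : ℂ), z + u ∉ L.lattice :=
    (L.isOpen_compl_lattice_add u).mem_nhds (by simpa using hu)
  have hov : ∀ᶠ z in 𝓝 (0 : ℂ), z + v ∉ L.lattice :=
    (L.isOpen_compl_lattice_add v).mem_nhds (by simpa using hv)
  have hau := L.analyticAt_weierstrassP_add u (z := 0) (by simpa using hu)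
  have hav := L.analyticAt_weierstrassP_add v (z := 0) (by simpa using hv)
  have hd : ∀ z, z + u ∉ L.lattice → z + v ∉ L.lattice →
      HasDerivAt h (L.derivWeierstrassP (z + u) - L.derivWeierstrassP (z + v)) z := by
    intro z hzu hzv
    exact ((L.hasDerivAt_weierstrassP hzu).comp_add_const z u).sub
      ((L.hasDerivAt_weierstrassP hzv).comp_add_const z v)
  have hd2 : ∀ z, z + u ∉ L.lattice → z + v ∉ L.lattice →
      HasDerivAt (fun z => L.derivWeierstrassP (z + u) - L.derivWeierstrassP (z + v))
        ((6 * L.weierstrassP (z + u) ^ 2 - L.g₂ / 2) -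
          (6 * L.weierstrassP (z + v) ^ 2 - L.g₂ / 2)) z := by
    intro z hzu hzv
    exact ((L.hasDerivAt_derivWeierstrassP hzu).comp_add_const z u).sub
      ((L.hasDerivAt_derivWeierstrassP hzv).comp_add_const z v)
  have hde : ∀ᶠ z in 𝓝 (0 : ℂ),
      deriv h z = L.derivWeierstrassP (z + u) - L.derivWeierstrassP (z + v) := by
    filter_upwards [hou, hov] with z hz1 hz2 using (hd z hz1 hz2).deriv
  -- By `℘'' = 6℘² - g₂/2` the difference `h` solves a linear equation of second order, with zero
  -- initial data at `0`.
  have hz : ∀ᶠ w in 𝓝 (0 : ℂ), h w = 0 := by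
    apply AnalyticAt.eventually_eq_zero_of_deriv_deriv
      (φ := fun z => 6 * (L.weierstrassP (z + u) + L.weierstrassP (z + v)))
    · exact hau.sub hav
    · fun_prop
    · simp [hdef, h0]
    · rw [hde.self_of_nhds]; simp [h1]
    · filter_upwards [hde.eventually_nhds, hou, hov] with z hz hz1 hz2
      rw [Filter.EventuallyEq.deriv_eq hz, (hd2 z hz1 hz2).deriv]
      simp only [hdef]
      ring
  -- The pole `-v` of `℘(z + v)` must be a pole of `℘(z + u)`.
  have := L.add_mem_lattice_of_eventuallyEq L (a := v) (b := u) (z₀ := 0) (by simpa using hv)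
    (by simpa using hu) (by filter_upwards [hz] with w hw using (sub_eq_zero.mp hw).symm)
    (z := -v) (by simp)
  rwa [neg_add_eq_sub] at this

end PeriodPair

end

/-! ### Lattices are determined by `g₂` and `g₃`; half periods and Legendre curves -/

noncomputable section

namespace PeriodPair

open Filter Topology

variable (L M : PeriodPair)

/-- A nonzero analytic function with `A z h' = C h` near `0` satisfies `C(0) = n A(0)` with `n` a
natural number. -/
lemma _root_.AnalyticAt.eventually_eq_zero_of_euler {h A C : ℂ → ℂ}
    (hh : AnalyticAt ℂ h 0) (hA : ContinuousAt A 0) (hC : ContinuousAt C 0)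
    (hAC : ∀ n : ℕ, A 0 * n ≠ C 0)
    (heq : ∀ᶠ z in 𝓝[≠] (0 : ℂ), A z * (z * deriv h z) = C z * h z) :
    ∀ᶠ z in 𝓝 (0 : ℂ), h z = 0 := by
  by_contra hne
  obtain ⟨n, k, hk, hk0, hhk⟩ := (hh.exists_eventuallyEq_pow_smul_nonzero_iff).mpr hne
  simp only [sub_zero, smul_eq_mul] at hhk
  have hderiv : ∀ᶠ z in 𝓝[≠] (0 : ℂ), z * deriv h z = z ^ n * (n * k z + z * deriv k z) := by
    filter_upwards [hhk.eventually_nhds.filter_mono nhdsWithin_le_nhds,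
      hk.eventually_analyticAt.filter_mono nhdsWithin_le_nhds, self_mem_nhdsWithin] with z hz hkz hz0
    have hz0 : z ≠ 0 := hz0
    rw [Filter.EventuallyEq.deriv_eq hz]
    have := ((hasDerivAt_pow n z).mul hkz.differentiableAt.hasDerivAt).deriv
    simp only [Pi.mul_def] at this
    rw [this]
    rcases n with _ | n
    · simp
    · simp only [Nat.add_sub_cancel, pow_succ]; ring
  have hlim : ∀ᶠ z in 𝓝[≠] (0 : ℂ), A z * (n * k z + z * deriv k z) = C z * k z := by
    filter_upwards [hderiv, heq, hhk.filter_mono nhdsWithin_le_nhds, self_mem_nhdsWithin]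
      with z h1 h2 h3 hz0
    have hz0 : z ≠ 0 := hz0
    rw [h1, h3] at h2
    have : z ^ n ≠ 0 := pow_ne_zero _ hz0
    apply mul_left_cancel₀ this
    linear_combination h2
  have hkc := hk.continuousAt
  have hkd := hk.deriv.continuousAt
  have c1 : ContinuousAt (fun z => A z * (n * k z + z * deriv k z)) 0 := by fun_prop
  have c2 : ContinuousAt (fun z => C z * k z) 0 := by fun_prop
  have t1 := (c1.tendsto.mono_left (nhdsWithin_le_nhds (s := {0}ᶜ)))
  have t2 := (c2.tendsto.mono_left (nhdsWithin_le_nhds (s := {0}ᶜ)))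
  have := tendsto_nhds_unique (t1.congr' hlim) t2
  simp only [zero_mul, add_zero] at this
  apply hAC n
  apply mul_right_cancel₀ hk0
  linear_combination this

/-- Near `0`, `℘(z) = z⁻² + F(z)` with `F` analytic. -/
lemma weierstrassP_eq_inv_sq_add {z : ℂ} : L.weierstrassP z = 1 / z ^ 2 + L.weierstrassPExcept 0 z := by
  have := L.weierstrassPExcept_add 0 z
  simp at this
  rw [← this]
  simp [add_comm]

lemma eventually_notMem_lattice : ∀ᶠ z in 𝓝[≠] (0 : ℂ), z ∉ L.lattice := by
  simpa using L.eventually_add_notMem_lattice 0 0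

/-- The lattice is determined by its invariants. -/
lemma lattice_le_of_invariants_eq (h2 : L.g₂ = M.g₂) (h3 : L.g₃ = M.g₃) :
    L.lattice ≤ M.lattice := by
  set F := L.weierstrassPExcept 0
  set G := M.weierstrassPExcept 0
  have hF : AnalyticAt ℂ F 0 := L.analyticAt_weierstrassPExcept 0
  have hG : AnalyticAt ℂ G 0 := M.analyticAt_weierstrassPExcept 0
  have hFc := hF.continuousAt
  have hGc := hG.continuousAt
  have hFd := hF.deriv.continuousAt
  have hGd := hG.deriv.continuousAt
  -- Write `℘ = z⁻² + F` and `z⁻² + G` for the two lattices, subtract the two differential equations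
  -- and multiply by `z⁴`. This is an Euler equation for `F - G` with `A(0) = -4` and `C(0) = 12`,
  -- and `-4n = 12` has no solution `n ≥ 0`.
  have hz : ∀ᶠ z in 𝓝 (0 : ℂ), F z - G z = 0 := by
    apply AnalyticAt.eventually_eq_zero_of_euler (h := fun z => F z - G z)
      (A := fun z => -4 + z ^ 3 * (deriv F z + deriv G z))
      (C := fun z => 4 * ((1 + z ^ 2 * F z) ^ 2 + (1 + z ^ 2 * F z) * (1 + z ^ 2 * G z)
        + (1 + z ^ 2 * G z) ^ 2) - L.g₂ * z ^ 4)
    · exact hF.sub hG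
    · fun_prop
    · fun_prop
    · intro n hn
      norm_num at hn
      have : ((4 * n + 12 : ℕ) : ℂ) = 0 := by push_cast; linear_combination -hn
      rw [Nat.cast_eq_zero] at this
      omega
    · filter_upwards [L.eventually_notMem_lattice, M.eventually_notMem_lattice, self_mem_nhdsWithin,
        hF.eventually_analyticAt.filter_mono nhdsWithin_le_nhds,
        hG.eventually_analyticAt.filter_mono nhdsWithin_le_nhds] with z hzL hzM hz0 hFz hGz
      have hz0 : z ≠ 0 := hz0
      have dF : L.derivWeierstrassP z = -2 / z ^ 3 + deriv F z := by
        rw [← (L.hasDerivAt_weierstrassP hzL).deriv,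
          show L.weierstrassP = fun z => 1 / z ^ 2 + F z from
            funext fun z => L.weierstrassP_eq_inv_sq_add]
        have h1 : HasDerivAt (fun z : ℂ => 1 / z ^ 2) (-2 / z ^ 3) z := by
          have := (hasDerivAt_pow 2 z).fun_inv (pow_ne_zero 2 hz0)
          simp only [one_div]
          refine this.congr_deriv ?_
          push_cast
          field_simp
        exact (h1.add hFz.differentiableAt.hasDerivAt).deriv
      have dG : M.derivWeierstrassP z = -2 / z ^ 3 + deriv G z := by
        rw [← (M.hasDerivAt_weierstrassP hzM).deriv,
          show M.weierstrassP = fun z => 1 / z ^ 2 + G z from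
            funext fun z => M.weierstrassP_eq_inv_sq_add]
        have h1 : HasDerivAt (fun z : ℂ => 1 / z ^ 2) (-2 / z ^ 3) z := by
          have := (hasDerivAt_pow 2 z).fun_inv (pow_ne_zero 2 hz0)
          simp only [one_div]
          refine this.congr_deriv ?_
          push_cast
          field_simp
        exact (h1.add hGz.differentiableAt.hasDerivAt).deriv
      have r1 := L.derivWeierstrassP_sq z hzL
      have r2 := M.derivWeierstrassP_sq z hzM
      rw [dF, L.weierstrassP_eq_inv_sq_add] at r1
      rw [dG, M.weierstrassP_eq_inv_sq_add, ← h2, ← h3] at r2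
      have hd : deriv (fun z => F z - G z) z = deriv F z - deriv G z :=
        deriv_fun_sub hFz.differentiableAt hGz.differentiableAt
      rw [hd]
      change (-2 / z ^ 3 + deriv F z) ^ 2 = 4 * (1 / z ^ 2 + F z) ^ 3 -
        L.g₂ * (1 / z ^ 2 + F z) - L.g₃ at r1
      change (-2 / z ^ 3 + deriv G z) ^ 2 = 4 * (1 / z ^ 2 + G z) ^ 3 -
        L.g₂ * (1 / z ^ 2 + G z) - L.g₃ at r2
      have r3 : ((-2 / z ^ 3 + deriv F z) ^ 2 - (-2 / z ^ 3 + deriv G z) ^ 2) * z ^ 4 =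
        ((4 * (1 / z ^ 2 + F z) ^ 3 - L.g₂ * (1 / z ^ 2 + F z) - L.g₃) -
          (4 * (1 / z ^ 2 + G z) ^ 3 - L.g₂ * (1 / z ^ 2 + G z) - L.g₃)) * z ^ 4 := by
        rw [r1, r2]
      have e1 : (-4 + z ^ 3 * (deriv F z + deriv G z)) * (z * (deriv F z - deriv G z)) =
          ((-2 / z ^ 3 + deriv F z) ^ 2 - (-2 / z ^ 3 + deriv G z) ^ 2) * z ^ 4 := by
        field_simp
        ring
      rw [e1, r3]
      field_simp
      ring
  intro l hl
  obtain ⟨z₀, ⟨hz1, hz2⟩, hz3⟩ := ((L.eventually_notMem_lattice.and M.eventually_notMem_lattice).and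
    (hz.eventually_nhds.filter_mono nhdsWithin_le_nhds)).exists
  have := L.add_mem_lattice_of_eventuallyEq M (a := 0) (b := 0) (z₀ := z₀) (by simpa using hz1)
    (by simpa using hz2) (by
      filter_upwards [hz3] with w hw
      rw [add_zero, L.weierstrassP_eq_inv_sq_add, M.weierstrassP_eq_inv_sq_add]
      exact congrArg _ (sub_eq_zero.mp hw)) (z := l) (by simpa using hl)
  simpa using this

lemma lattice_eq_of_invariants_eq (h2 : L.g₂ = M.g₂) (h3 : L.g₃ = M.g₃) : L.lattice = M.lattice :=
  le_antisymm (L.lattice_le_of_invariants_eq M h2 h3) (M.lattice_le_of_invariants_eq L h2.symm h3.symm)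

/-! ### Homothetic lattices -/

section Homothety

variable {L M} {c : ℂ} (hc : c ≠ 0) (h : ∀ z, c * z ∈ M.lattice ↔ z ∈ L.lattice)

/-- Multiplication by `c` as a bijection between homothetic lattices. -/
def latticeEquivOfHomothety : L.lattice ≃ M.lattice where
  toFun z := ⟨c * z, (h z).mpr z.2⟩
  invFun w := ⟨c⁻¹ * w, (h _).mp (by rw [mul_inv_cancel_left₀ hc]; exact w.2)⟩
  left_inv z := by ext; simp [hc]
  right_inv z := by ext; simp [hc]

include hc h

lemma weierstrassP_homothety (z : ℂ) : M.weierstrassP (c * z) = L.weierstrassP z / c ^ 2 := by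
  rw [weierstrassP, weierstrassP, ← (latticeEquivOfHomothety hc h).tsum_eq, ← tsum_div_const]
  congr with l
  simp only [latticeEquivOfHomothety, Equiv.coe_fn_mk, ← mul_sub, mul_pow]
  rw [sub_div, div_div, div_div, mul_comm (c ^ 2), mul_comm (c ^ 2)]

lemma G_homothety (n : ℕ) : M.G n = L.G n / c ^ n := by
  rw [G, G, ← (latticeEquivOfHomothety hc h).tsum_eq, ← tsum_div_const]
  congr with l
  simp only [latticeEquivOfHomothety, Equiv.coe_fn_mk, mul_pow, mul_inv]
  field_simp

lemma g₂_homothety : M.g₂ = L.g₂ / c ^ 4 := by rw [g₂, g₂, G_homothety hc h]; ring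

lemma g₃_homothety : M.g₃ = L.g₃ / c ^ 6 := by rw [g₃, g₃, G_homothety hc h]; ring

end Homothety

/-! ### Half periods -/

lemma add_div_two_notMem_lattice : (L.ω₁ + L.ω₂) / 2 ∉ L.lattice := by
  have := (L.mul_ω₁_add_mul_ω₂_mem_lattice (α := 1 / 2) (β := 1 / 2)).not.mpr (by norm_num)
  convert this using 2
  push_cast; ring

lemma sub_div_two_notMem_lattice : (L.ω₁ - L.ω₂) / 2 ∉ L.lattice := by
  have := (L.mul_ω₁_add_mul_ω₂_mem_lattice (α := 1 / 2) (β := -1 / 2)).not.mpr (by norm_num)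
  convert this using 2
  push_cast; ring

/-- `℘'` is odd and periodic. -/
lemma derivWeierstrassP_half {w : ℂ} (hw : w ∈ L.lattice) : L.derivWeierstrassP (w / 2) = 0 := by
  have h1 := L.derivWeierstrassP_add_coe (-(w / 2)) ⟨w, hw⟩
  rw [L.derivWeierstrassP_neg] at h1
  have : -(w / 2) + w = w / 2 := by ring
  simp only [this] at h1
  exact self_eq_neg.mp h1

/-- The value of `℘` at the half period `ω₁ / 2`. -/
def e₁ : ℂ := L.weierstrassP (L.ω₁ / 2)

/-- The value of `℘` at the half period `ω₂ / 2`. -/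
def e₂ : ℂ := L.weierstrassP (L.ω₂ / 2)

/-- The value of `℘` at the half period `(ω₁ + ω₂) / 2`. -/
def e₃ : ℂ := L.weierstrassP ((L.ω₁ + L.ω₂) / 2)

lemma weierstrassP_half_ne {v w : ℂ} (hv : v ∈ L.lattice) (hw : w ∈ L.lattice)
    (hv2 : v / 2 ∉ L.lattice) (hw2 : w / 2 ∉ L.lattice) (hvw : (v - w) / 2 ∉ L.lattice) :
    L.weierstrassP (v / 2) ≠ L.weierstrassP (w / 2) := by
  intro heq
  have := L.sub_mem_lattice_of_weierstrassP_eq hv2 hw2 heq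
    (by rw [L.derivWeierstrassP_half hv, L.derivWeierstrassP_half hw])
  rw [← sub_div] at this
  exact hvw this

lemma e₁_ne_e₂ : L.e₁ ≠ L.e₂ :=
  L.weierstrassP_half_ne L.ω₁_mem_lattice L.ω₂_mem_lattice L.ω₁_div_two_notMem_lattice
    L.ω₂_div_two_notMem_lattice L.sub_div_two_notMem_lattice

lemma e₃_ne_e₁ : L.e₃ ≠ L.e₁ :=
  L.weierstrassP_half_ne (add_mem L.ω₁_mem_lattice L.ω₂_mem_lattice) L.ω₁_mem_lattice
    L.add_div_two_notMem_lattice L.ω₁_div_two_notMem_lattice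
    (by simpa using L.ω₂_div_two_notMem_lattice)

lemma e₃_ne_e₂ : L.e₃ ≠ L.e₂ :=
  L.weierstrassP_half_ne (add_mem L.ω₁_mem_lattice L.ω₂_mem_lattice) L.ω₂_mem_lattice
    L.add_div_two_notMem_lattice L.ω₂_div_two_notMem_lattice
    (by simpa using L.ω₁_div_two_notMem_lattice)

lemma cubic_half_period {w : ℂ} (hw : w ∈ L.lattice) (hw2 : w / 2 ∉ L.lattice) :
    4 * L.weierstrassP (w / 2) ^ 3 - L.g₂ * L.weierstrassP (w / 2) - L.g₃ = 0 := by
  rw [← L.derivWeierstrassP_sq _ hw2, L.derivWeierstrassP_half hw]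
  simp

/-- The half-period values are three distinct roots of `4x³ - g₂x - g₃`, and these are Vieta's
formulas. -/
lemma invariants_eq : L.e₃ = -L.e₁ - L.e₂ ∧ L.g₂ = 4 * (L.e₁ ^ 2 + L.e₁ * L.e₂ + L.e₂ ^ 2) ∧
    L.g₃ = -4 * L.e₁ * L.e₂ * (L.e₁ + L.e₂) := by
  have c1 := L.cubic_half_period L.ω₁_mem_lattice L.ω₁_div_two_notMem_lattice
  have c2 := L.cubic_half_period L.ω₂_mem_lattice L.ω₂_div_two_notMem_lattice
  have c3 := L.cubic_half_period (add_mem L.ω₁_mem_lattice L.ω₂_mem_lattice)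
    L.add_div_two_notMem_lattice
  change 4 * L.e₁ ^ 3 - L.g₂ * L.e₁ - L.g₃ = 0 at c1
  change 4 * L.e₂ ^ 3 - L.g₂ * L.e₂ - L.g₃ = 0 at c2
  change 4 * L.e₃ ^ 3 - L.g₂ * L.e₃ - L.g₃ = 0 at c3
  have n12 := sub_ne_zero.mpr L.e₁_ne_e₂
  have n31 := sub_ne_zero.mpr L.e₃_ne_e₁
  have n32 := sub_ne_zero.mpr L.e₃_ne_e₂
  have h2 : L.g₂ = 4 * (L.e₁ ^ 2 + L.e₁ * L.e₂ + L.e₂ ^ 2) := by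
    apply mul_left_cancel₀ n12
    linear_combination -c1 + c2
  have h2' : L.g₂ = 4 * (L.e₃ ^ 2 + L.e₃ * L.e₂ + L.e₂ ^ 2) := by
    apply mul_left_cancel₀ n32
    linear_combination -c3 + c2
  have h3 : L.e₃ = -L.e₁ - L.e₂ := by
    apply mul_left_cancel₀ n31
    linear_combination (h2 - h2') / 4
  refine ⟨h3, h2, ?_⟩
  linear_combination -c1 - L.e₁ * h2

/-! ### Uniformization of Legendre curves -/

/-- The shift by `(1 + l)/3` removes the quadratic term of the Legendre cubic, which leaves the
Weierstrass form. -/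
lemma equation_legendreCurve (l P Q : ℂ) :
    (legendreCurve l).toAffine.Equation (4 * P + (1 + l) / 3) (4 * Q) ↔
      Q ^ 2 = 4 * P ^ 3 - (l ^ 2 - l + 1) / 12 * P - (1 + l) * (2 - l) * (1 - 2 * l) / 432 := by
  rw [WeierstrassCurve.Affine.equation_iff]
  simp only [legendreCurve]
  constructor <;> intro h
  · linear_combination h / 16
  · linear_combination 16 * h

/-- Two cubics in `℘` with equal leading terms and no quadratic terms coincide once they agree at
the distinct values `e₁` and `e₂`. -/
lemma uniformizesLegendre_iff (l : ℂ) : UniformizesLegendre L l ↔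
    L.g₂ = (l ^ 2 - l + 1) / 12 ∧ L.g₃ = (1 + l) * (2 - l) * (1 - 2 * l) / 432 := by
  simp only [UniformizesLegendre, equation_legendreCurve]
  constructor
  · intro h
    have a1 := h _ L.ω₁_div_two_notMem_lattice
    have a2 := h _ L.ω₂_div_two_notMem_lattice
    rw [L.derivWeierstrassP_sq _ L.ω₁_div_two_notMem_lattice] at a1
    rw [L.derivWeierstrassP_sq _ L.ω₂_div_two_notMem_lattice] at a2
    change 4 * L.e₁ ^ 3 - L.g₂ * L.e₁ - L.g₃ = 4 * L.e₁ ^ 3 - _ * L.e₁ - _ at a1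
    change 4 * L.e₂ ^ 3 - L.g₂ * L.e₂ - L.g₃ = 4 * L.e₂ ^ 3 - _ * L.e₂ - _ at a2
    have h2 : L.g₂ = (l ^ 2 - l + 1) / 12 := by
      apply mul_left_cancel₀ (sub_ne_zero.mpr L.e₁_ne_e₂)
      linear_combination a2 - a1
    exact ⟨h2, by linear_combination -a1 - L.e₁ * h2⟩
  · rintro ⟨h2, h3⟩ z hz
    rw [L.derivWeierstrassP_sq z hz, h2, h3]

lemma periodLattice_eq {l : ℂ} (h : UniformizesLegendre L l) : periodLattice l = L.lattice := by
  apply le_antisymm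
  · refine iSup₂_le fun M hM => ?_
    rw [uniformizesLegendre_iff] at h hM
    exact (lattice_eq_of_invariants_eq M L (hM.1.trans h.1.symm) (hM.2.trans h.2.symm)).le
  · exact le_iSup₂_of_le L h le_rfl

end PeriodPair

end

/-! ### The lattices `ℤ + ℤτ`; holomorphy in `τ` of `℘` at division points -/

noncomputable section

open Filter Topology UpperHalfPlane

lemma UpperHalfPlane.linearIndependent_one_coe (τ : ℍ) :
    LinearIndependent ℝ ![(1 : ℂ), (τ : ℂ)] := by
  rw [LinearIndependent.pair_iff]
  intro s t h
  have him := congrArg Complex.im h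
  have ht : t = 0 := by
    simpa [τ.im_pos.ne'] using him
  subst ht
  simpa using h

/-- The periods `1, τ`. -/
def UpperHalfPlane.periodPair (τ : ℍ) : PeriodPair := ⟨1, τ, τ.linearIndependent_one_coe⟩

lemma UpperHalfPlane.mem_lattice_periodPair {τ : ℍ} {z : ℂ} :
    z ∈ τ.periodPair.lattice ↔ ∃ m n : ℤ, m + n * (τ : ℂ) = z := by
  simp [PeriodPair.mem_lattice, periodPair]

/-- The parametrization of the lattice `ℤ + ℤ τ` by `ℤ²`. -/
def UpperHalfPlane.latticeParam (τ : ℍ) : (Fin 2 → ℤ) ≃ τ.periodPair.lattice :=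
  ((finTwoArrowEquiv ℤ).trans (Equiv.prodComm ℤ ℤ)).trans τ.periodPair.latticeEquivProd.symm.toEquiv

lemma UpperHalfPlane.latticeParam_apply (τ : ℍ) (v : Fin 2 → ℤ) :
    (τ.latticeParam v : ℂ) = v 0 * τ + v 1 := by
  simp only [latticeParam, Equiv.trans_apply, finTwoArrowEquiv_apply, Equiv.prodComm_apply]
  refine (τ.periodPair.latticeEquiv_symm_apply (v 1, v 0)).trans ?_
  simp [periodPair, add_comm]

/-- The value of `℘` for the lattice `ℤ + ℤ z` at the point `a z + b`, as a function of `z`. -/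
def divisionValue (a b : ℝ) (z : ℂ) : ℂ :=
  ∑' v : Fin 2 → ℤ, (1 / (a * z + b - (v 0 * z + v 1)) ^ 2 - 1 / (v 0 * z + v 1) ^ 2)

lemma divisionValue_eq (a b : ℝ) (τ : ℍ) :
    divisionValue a b τ = τ.periodPair.weierstrassP (a * τ + b) := by
  rw [PeriodPair.weierstrassP, ← τ.latticeParam.tsum_eq, divisionValue]
  simp only [UpperHalfPlane.latticeParam_apply]

/-- Weierstrass M-test: over a compact set the lattice vectors satisfy `|v₀z + v₁| ≥ c‖v‖`
uniformly, so the terms are `O(‖v‖⁻³)`. The hypothesis keeps `az + b` off the lattice. -/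
lemma differentiableOn_divisionValue {a b : ℝ} (hab : ∀ m n : ℤ, (a, b) ≠ ((m : ℝ), (n : ℝ))) :
    DifferentiableOn ℂ (divisionValue a b) {z | 0 < z.im} := by
  have hopen : IsOpen {z : ℂ | 0 < z.im} := isOpen_lt continuous_const Complex.continuous_im
  apply SummableLocallyUniformlyOn.differentiableOn hopen
  · apply SummableLocallyUniformlyOn.of_locally_bounded_eventually hopen
    intro K hK hKc
    have hK' : IsCompact ((↑) ⁻¹' K : Set ℍ) := by
      apply isOpenEmbedding_coe.isInducing.isCompact_preimage' hKc
      intro z hz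
      exact ⟨⟨z, hK hz⟩, rfl⟩
    obtain ⟨A, B, hB, hAB⟩ := subset_verticalStrip_of_isCompact hK'
    set c := EisensteinSeries.r ⟨⟨A, B⟩, hB⟩ with hc
    have hc0 : 0 < c := EisensteinSeries.r_pos _
    have hbd : Bornology.IsBounded ((fun z : ℂ => (a : ℂ) * z + b) '' K) :=
      (hKc.image (by fun_prop)).isBounded
    obtain ⟨R, hR0, hR⟩ := hbd.exists_pos_norm_lt
    refine ⟨fun v => 10 * R * c ^ (-3 : ℝ) * ‖v‖ ^ (-3 : ℝ),
      (EisensteinSeries.summable_one_div_norm_rpow (by norm_num)).mul_left _, ?_⟩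
    -- The bound on the terms of `℘` at points of norm below `R` needs lattice vectors of norm at
    -- least `2R`.
    have hcof : ∀ᶠ v : Fin 2 → ℤ in cofinite, 2 * R / c ≤ ‖v‖ ∧ v ≠ 0 := by
      apply Filter.Eventually.and
      · rw [← Filter.cocompact_eq_cofinite]
        exact tendsto_norm_cocompact_atTop.eventually_ge_atTop _
      · exact (Set.finite_singleton (0 : Fin 2 → ℤ)).eventually_cofinite_notMem
    filter_upwards [hcof] with v hv z hz
    obtain ⟨hv1, hv0⟩ := hv
    have hzs : (⟨z, hK hz⟩ : ℍ) ∈ verticalStrip A B := hAB hz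
    have hl : c * ‖v‖ ≤ ‖(v 0 : ℂ) * z + v 1‖ := by
      refine le_trans ?_ (EisensteinSeries.r_mul_max_le ⟨z, hK hz⟩ hv0)
      gcongr
      exact EisensteinSeries.r_lower_bound_on_verticalStrip _ hB hzs
    have hvpos : 0 < ‖v‖ := norm_pos_iff.mpr hv0
    have h2R : 2 * R ≤ c * ‖v‖ := by
      rw [div_le_iff₀ hc0] at hv1
      linarith
    refine (PeriodPair.weierstrassP_bound R hR0 _ (hR _ ⟨z, hz, rfl⟩) _ (h2R.trans hl)).trans ?_
    have h3 : ‖(v 0 : ℂ) * z + v 1‖ ^ (-3 : ℝ) ≤ c ^ (-3 : ℝ) * ‖v‖ ^ (-3 : ℝ) := by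
      rw [← Real.mul_rpow hc0.le hvpos.le]
      exact Real.rpow_le_rpow_of_nonpos (by positivity) hl (by norm_num)
    calc _ ≤ 10 * R * (c ^ (-3 : ℝ) * ‖v‖ ^ (-3 : ℝ)) := by gcongr
      _ = _ := by ring
  · intro v z hz
    have hz : 0 < z.im := hz
    have h1 : (a : ℂ) * z + b - (v 0 * z + v 1) ≠ 0 := by
      intro h
      have him := congrArg Complex.im h
      have hre := congrArg Complex.re h
      simp only [Complex.sub_im, Complex.add_im, Complex.mul_im, Complex.ofReal_re,
        Complex.ofReal_im, zero_mul, add_zero, Complex.intCast_re, Complex.intCast_im,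
        Complex.zero_im] at him
      have ha : a = v 0 := by
        rw [← sub_mul] at him
        linarith [(mul_eq_zero.mp him).resolve_right hz.ne']
      simp only [Complex.sub_re, Complex.add_re, Complex.mul_re, Complex.ofReal_re,
        Complex.ofReal_im, zero_mul, sub_zero, Complex.intCast_re, Complex.intCast_im,
        Complex.zero_re, ha] at hre
      exact hab (v 0) (v 1) (Prod.ext ha (by simp; linarith))
    by_cases h2 : (v 0 : ℂ) * z + v 1 = 0
    -- This is the term `v = 0`, where the second fraction is `1 / 0 = 0` by convention.
    · have hv : v 0 = 0 ∧ v 1 = 0 := by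
        have him := congrArg Complex.im h2
        simp only [Complex.add_im, Complex.mul_im, Complex.intCast_re, Complex.intCast_im,
          zero_mul, add_zero, Complex.zero_im] at him
        have hv0 := (mul_eq_zero.mp him).resolve_right hz.ne'
        have hv0' : v 0 = 0 := by exact_mod_cast hv0
        rw [hv0'] at h2
        exact ⟨hv0', by simpa using h2⟩
      simp only [hv.1, hv.2, Int.cast_zero, zero_mul, add_zero, sub_zero] at h1 ⊢
      fun_prop (disch := positivity)
    · have h1' := pow_ne_zero 2 h1
      have h2' := pow_ne_zero 2 h2
      fun_prop (disch := assumption)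

end

noncomputable section

open Filter Topology UpperHalfPlane

open scoped MatrixGroups

/-! ### The modular function `λ` -/

lemma isOpen_im_pos : IsOpen {z : ℂ | 0 < z.im} :=
  isOpen_lt continuous_const Complex.continuous_im

/-- `℘(1 / 2) - ℘(z / 2)` for the lattice `ℤ + ℤ z`. -/
def halfPeriodDiff (z : ℂ) : ℂ := divisionValue 0 (1 / 2) z - divisionValue (1 / 2) 0 z

/-- The modular function `λ`, as a function on `ℂ` (meaningful on the upper half plane). -/
def modularLambda (z : ℂ) : ℂ :=
  (divisionValue (1 / 2) (1 / 2) z - divisionValue (1 / 2) 0 z) / halfPeriodDiff z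

lemma divisionValue_zero_half (τ : ℍ) : divisionValue 0 (1 / 2) τ = τ.periodPair.e₁ := by
  rw [divisionValue_eq, PeriodPair.e₁]
  congr 1
  simp [periodPair]

lemma divisionValue_half_zero (τ : ℍ) : divisionValue (1 / 2) 0 τ = τ.periodPair.e₂ := by
  rw [divisionValue_eq, PeriodPair.e₂]
  congr 1
  simp [periodPair]
  ring

lemma divisionValue_half_half (τ : ℍ) : divisionValue (1 / 2) (1 / 2) τ = τ.periodPair.e₃ := by
  rw [divisionValue_eq, PeriodPair.e₃]
  congr 1
  simp [periodPair]
  ring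

lemma half_ne_intCast (n : ℤ) : (1 / 2 : ℝ) ≠ n := by
  intro h
  have : (1 : ℤ) = 2 * n := by exact_mod_cast (show (1 : ℝ) = 2 * n by linarith)
  omega

lemma differentiableOn_halfPeriodDiff : DifferentiableOn ℂ halfPeriodDiff {z | 0 < z.im} := by
  apply DifferentiableOn.fun_sub <;> apply differentiableOn_divisionValue <;> intro m n h
  · exact half_ne_intCast n (congrArg Prod.snd h)
  · exact half_ne_intCast m (congrArg Prod.fst h)

lemma halfPeriodDiff_coe (τ : ℍ) : halfPeriodDiff τ = τ.periodPair.e₁ - τ.periodPair.e₂ := by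
  rw [halfPeriodDiff, divisionValue_zero_half, divisionValue_half_zero]

lemma halfPeriodDiff_ne_zero {z : ℂ} (hz : 0 < z.im) : halfPeriodDiff z ≠ 0 := by
  have := halfPeriodDiff_coe ⟨z, hz⟩
  rw [show halfPeriodDiff z = _ from this]
  exact sub_ne_zero.mpr (PeriodPair.e₁_ne_e₂ _)

lemma differentiableOn_modularLambda : DifferentiableOn ℂ modularLambda {z | 0 < z.im} := by
  apply DifferentiableOn.fun_div _ differentiableOn_halfPeriodDiff
    (fun z hz => halfPeriodDiff_ne_zero hz)
  apply DifferentiableOn.fun_sub <;> apply differentiableOn_divisionValue <;> intro m n h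
  · exact half_ne_intCast m (congrArg Prod.fst h)
  · exact half_ne_intCast m (congrArg Prod.fst h)

lemma modularLambda_coe (τ : ℍ) : modularLambda τ =
    (τ.periodPair.e₃ - τ.periodPair.e₂) / (τ.periodPair.e₁ - τ.periodPair.e₂) := by
  rw [modularLambda, divisionValue_half_half, divisionValue_half_zero, halfPeriodDiff_coe]

lemma modularLambda_mem (τ : ℍ) : modularLambda τ ∈ legendreBase := by
  have h12 := sub_ne_zero.mpr τ.periodPair.e₁_ne_e₂
  have h31 := sub_ne_zero.mpr τ.periodPair.e₃_ne_e₁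
  have h32 := sub_ne_zero.mpr τ.periodPair.e₃_ne_e₂
  rw [modularLambda_coe]
  refine ⟨div_ne_zero h32 h12, fun h => h31 ?_⟩
  rw [div_eq_one_iff_eq h12] at h
  linear_combination h

/-- The upper half plane is simply connected and `e₁ - e₂` has no zero on it. -/
lemma exists_sqrt_halfPeriodDiff : ∃ f : ℂ → ℂ, ContinuousOn f {z | 0 < z.im} ∧
    ∀ z, f z ^ 2 = 4 * halfPeriodDiff z := by
  apply Complex.exists_continuousOn_pow_eq _ isOpen_im_pos _ _ two_ne_zero
  · have : Convex ℝ {z : ℂ | 0 < z.im} := convex_halfSpace_im_gt 0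
    have : ContractibleSpace {z : ℂ | 0 < z.im} :=
      this.contractibleSpace ⟨Complex.I, by simp⟩
    exact (inferInstance : SimplyConnectedSpace {z : ℂ | 0 < z.im})
  · exact differentiableOn_halfPeriodDiff.continuousOn.const_smul (4 : ℂ)
  · rintro ⟨z, hz, h⟩
    exact halfPeriodDiff_ne_zero hz (by simpa using h)

/-- A holomorphic square root of `4 (℘(1 / 2) - ℘(z / 2))` on the upper half plane: the lattice
`periodScale τ • (ℤ + ℤ τ)` uniformizes the Legendre curve with parameter `λ(τ)`. -/
def periodScale : ℂ → ℂ := exists_sqrt_halfPeriodDiff.choose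

lemma periodScale_sq (z : ℂ) : periodScale z ^ 2 = 4 * halfPeriodDiff z :=
  exists_sqrt_halfPeriodDiff.choose_spec.2 z

lemma continuousOn_periodScale : ContinuousOn periodScale {z | 0 < z.im} :=
  exists_sqrt_halfPeriodDiff.choose_spec.1

lemma periodScale_ne_zero {z : ℂ} (hz : 0 < z.im) : periodScale z ≠ 0 := by
  intro h
  have := periodScale_sq z
  rw [h] at this
  exact halfPeriodDiff_ne_zero hz (by simpa using this)

/-- For a continuous square root `f` of `g`, the slope of `f` from `z` to `w` is that of `g` divided
by `f(w) + f(z)`, whose limit `2f(z)` is nonzero. -/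
lemma differentiableAt_periodScale {z : ℂ} (hz : 0 < z.im) :
    DifferentiableAt ℂ periodScale z := by
  have hg : HasDerivAt (fun z => 4 * halfPeriodDiff z) (4 * deriv halfPeriodDiff z) z :=
    ((differentiableOn_halfPeriodDiff.differentiableAt
      (isOpen_im_pos.mem_nhds hz)).hasDerivAt).const_mul 4
  have hc : ContinuousAt periodScale z :=
    continuousOn_periodScale.continuousAt (isOpen_im_pos.mem_nhds hz)
  have hne := periodScale_ne_zero hz
  have hsum : periodScale z + periodScale z ≠ 0 := by
    rw [← two_mul]; exact mul_ne_zero two_ne_zero hne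
  suffices HasDerivAt periodScale
      ((periodScale z + periodScale z)⁻¹ * (4 * deriv halfPeriodDiff z)) z from
    this.differentiableAt
  rw [hasDerivAt_iff_tendsto_slope] at hg ⊢
  have hsumc : Tendsto (fun w => periodScale w + periodScale z) (𝓝[≠] z)
      (𝓝 (periodScale z + periodScale z)) :=
    (hc.tendsto.add_const _).mono_left nhdsWithin_le_nhds
  refine ((hsumc.inv₀ hsum).mul hg).congr' ?_
  filter_upwards [hsumc.eventually_ne hsum] with w hw
  simp only [slope_def_field, ← periodScale_sq]
  field_simp
  ring

/-- The periods of the Legendre curve with parameter `λ(τ)`. -/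
def UpperHalfPlane.scaledPair (τ : ℍ) : PeriodPair :=
  ⟨periodScale τ, periodScale τ * τ, by
    have h := τ.linearIndependent_one_coe
    rw [LinearIndependent.pair_iff] at h ⊢
    intro s t hst
    apply h
    apply mul_left_cancel₀ (periodScale_ne_zero τ.im_pos)
    rw [mul_zero, ← hst]
    simp only [Complex.real_smul]
    ring⟩

lemma UpperHalfPlane.mem_lattice_scaledPair {τ : ℍ} {z : ℂ} :
    z ∈ τ.scaledPair.lattice ↔ ∃ m n : ℤ, periodScale τ * (m + n * τ) = z := by
  rw [PeriodPair.mem_lattice]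
  simp only [scaledPair]
  refine exists₂_congr fun m n => ?_
  rw [show (m : ℂ) * periodScale τ + n * (periodScale τ * τ) = periodScale τ * (m + n * τ) by ring]

lemma UpperHalfPlane.mul_mem_lattice_scaledPair (τ : ℍ) (z : ℂ) :
    periodScale τ * z ∈ τ.scaledPair.lattice ↔ z ∈ τ.periodPair.lattice := by
  rw [mem_lattice_scaledPair, mem_lattice_periodPair]
  exact exists₂_congr fun m n => mul_right_inj' (periodScale_ne_zero τ.im_pos)

lemma periodScale_sq_coe (τ : ℍ) :
    periodScale τ ^ 2 = 4 * (τ.periodPair.e₁ - τ.periodPair.e₂) := by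
  rw [periodScale_sq, halfPeriodDiff_coe]

lemma modularLambda_coe' (τ : ℍ) : modularLambda τ =
    (-τ.periodPair.e₁ - 2 * τ.periodPair.e₂) / (τ.periodPair.e₁ - τ.periodPair.e₂) := by
  rw [modularLambda_coe, τ.periodPair.invariants_eq.1]
  ring

/-- In the coordinate `x = 4℘ + (1 + λ)/3` this is the branch point `x = 1`; the half period `ωτ/2`
below gives `x = 0`. This labelling of half periods by branch points forces base changes with equal
`λ` to be trivial modulo `2`. -/
lemma e₁_scaledPair (τ : ℍ) :
    τ.scaledPair.weierstrassP (periodScale τ / 2) = (2 - modularLambda τ) / 12 := by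
  have h := PeriodPair.weierstrassP_homothety (periodScale_ne_zero τ.im_pos)
    τ.mul_mem_lattice_scaledPair (1 / 2)
  rw [mul_one_div] at h
  have h12 := sub_ne_zero.mpr τ.periodPair.e₁_ne_e₂
  rw [h, show τ.periodPair.weierstrassP (1 / 2) = τ.periodPair.e₁ from rfl, periodScale_sq_coe,
    modularLambda_coe']
  field_simp
  ring

lemma e₂_scaledPair (τ : ℍ) :
    τ.scaledPair.weierstrassP (periodScale τ * τ / 2) = -(1 + modularLambda τ) / 12 := by
  have h := PeriodPair.weierstrassP_homothety (periodScale_ne_zero τ.im_pos)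
    τ.mul_mem_lattice_scaledPair (τ / 2)
  rw [← mul_div_assoc] at h
  have h12 := sub_ne_zero.mpr τ.periodPair.e₁_ne_e₂
  rw [h, show τ.periodPair.weierstrassP (τ / 2) = τ.periodPair.e₂ from rfl, periodScale_sq_coe,
    modularLambda_coe']
  field_simp
  ring

lemma uniformizesLegendre_scaledPair (τ : ℍ) :
    UniformizesLegendre τ.scaledPair (modularLambda τ) := by
  have h12 := sub_ne_zero.mpr τ.periodPair.e₁_ne_e₂
  obtain ⟨-, h2, h3⟩ := τ.periodPair.invariants_eq
  rw [PeriodPair.uniformizesLegendre_iff,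
    PeriodPair.g₂_homothety (periodScale_ne_zero τ.im_pos) τ.mul_mem_lattice_scaledPair,
    PeriodPair.g₃_homothety (periodScale_ne_zero τ.im_pos) τ.mul_mem_lattice_scaledPair,
    show periodScale τ ^ 4 = (periodScale τ ^ 2) ^ 2 by ring,
    show periodScale τ ^ 6 = (periodScale τ ^ 2) ^ 3 by ring, periodScale_sq_coe,
    modularLambda_coe', h2, h3]
  constructor
  · field_simp
    ring
  · field_simp
    ring

/-- The fundamental description of the period lattice. -/
lemma periodLattice_modularLambda (τ : ℍ) :
    periodLattice (modularLambda τ) = τ.scaledPair.lattice :=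
  PeriodPair.periodLattice_eq _ (uniformizesLegendre_scaledPair τ)

lemma mem_periodLattice_modularLambda {τ : ℍ} {z : ℂ} :
    z ∈ periodLattice (modularLambda τ) ↔ ∃ m n : ℤ, periodScale τ * (m + n * τ) = z := by
  rw [periodLattice_modularLambda, mem_lattice_scaledPair]

lemma UpperHalfPlane.intCast_add_mul_eq_zero {τ : ℍ} {m n : ℤ} (h : (m : ℂ) + n * τ = 0) :
    m = 0 ∧ n = 0 := by
  have := LinearIndependent.pair_iff.mp τ.linearIndependent_one_coe m n (by simpa using h)
  exact_mod_cast this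

lemma UpperHalfPlane.intCast_add_mul_inj {τ : ℍ} {m n m' n' : ℤ}
    (h : (m : ℂ) + n * τ = m' + n' * τ) : m = m' ∧ n = n' := by
  have := intCast_add_mul_eq_zero (τ := τ) (m := m - m') (n := n - n')
    (by push_cast; linear_combination h)
  omega

/-! ### The Sanov subgroup -/

/-- The subgroup of `SL₂(ℤ)` of all matrices that are congruent to the identity modulo `2`, with
diagonal entries congruent to `1` modulo `4`. -/
def sanovSubgroup : Subgroup SL(2, ℤ) where
  carrier := {g | 4 ∣ g 0 0 - 1 ∧ 2 ∣ g 0 1 ∧ 2 ∣ g 1 0 ∧ 4 ∣ g 1 1 - 1}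
  one_mem' := by simp
  mul_mem' := by
    rintro g h ⟨⟨a, ha⟩, ⟨b, hb⟩, ⟨c, hc⟩, ⟨d, hd⟩⟩ ⟨⟨a', ha'⟩, ⟨b', hb'⟩, ⟨c', hc'⟩, ⟨d', hd'⟩⟩
    simp only [Set.mem_ofPred_eq, Matrix.SpecialLinearGroup.coe_mul, Matrix.mul_apply,
      Fin.sum_univ_two]
    rw [sub_eq_iff_eq_add] at ha hd ha' hd'
    rw [ha, hb, hc, hd, ha', hb', hc', hd']
    refine ⟨⟨4 * a * a' + a + a' + b * c', by ring⟩, ⟨(4 * a + 1) * b' + b * (4 * d' + 1), by ring⟩,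
      ⟨c * (4 * a' + 1) + (4 * d + 1) * c', by ring⟩, ⟨4 * d * d' + d + d' + c * b', by ring⟩⟩
  inv_mem' := by
    rintro g ⟨ha, hb, hc, hd⟩
    rw [Matrix.SpecialLinearGroup.SL2_inv_expl]
    exact ⟨hd, (dvd_neg (a := (2 : ℤ))).mpr hb, (dvd_neg (a := (2 : ℤ))).mpr hc, ha⟩

lemma mem_sanovSubgroup {g : SL(2, ℤ)} : g ∈ sanovSubgroup ↔
    4 ∣ g 0 0 - 1 ∧ 2 ∣ g 0 1 ∧ 2 ∣ g 1 0 ∧ 4 ∣ g 1 1 - 1 := Iff.rfl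

lemma UpperHalfPlane.SL_denom_ne_zero (g : SL(2, ℤ)) (τ : ℍ) :
    ((g 1 0 : ℤ) : ℂ) * τ + (g 1 1 : ℤ) ≠ 0 := by
  intro h
  have h0 := intCast_add_mul_eq_zero (τ := τ) (m := g 1 1) (n := g 1 0) (by rw [add_comm]; exact h)
  have hdet := g.det_coe
  rw [Matrix.det_fin_two, h0.1, h0.2] at hdet
  simp at hdet

lemma UpperHalfPlane.SL_smul_mul_denom (g : SL(2, ℤ)) (τ : ℍ) :
    ((g • τ : ℍ) : ℂ) * ((g 1 0 : ℤ) * τ + (g 1 1 : ℤ)) = (g 0 0 : ℤ) * τ + (g 0 1 : ℤ) := by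
  rw [UpperHalfPlane.coe_specialLinearGroup_apply]
  simp only [eq_intCast, Complex.ofReal_intCast]
  exact div_mul_cancel₀ _ (SL_denom_ne_zero g τ)

lemma UpperHalfPlane.neg_SL_smul (g : SL(2, ℤ)) (τ : ℍ) : (-g) • τ = g • τ := by
  simp

/-- Multiplication by `cτ + d` sends `1, gτ` to `cτ + d, aτ + b`, a basis of `ℤ + ℤτ` because `det g
= 1`. -/
lemma mul_mem_lattice_SL_smul (g : SL(2, ℤ)) (τ : ℍ) (z : ℂ) :
    (((g 1 0 : ℤ) : ℂ) * τ + (g 1 1 : ℤ)) * z ∈ τ.periodPair.lattice ↔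
      z ∈ (g • τ).periodPair.lattice := by
  have hj := SL_denom_ne_zero g τ
  have hm := SL_smul_mul_denom g τ
  have hdet := g.det_coe
  rw [Matrix.det_fin_two] at hdet
  have hdet' : ((g 0 0 : ℤ) : ℂ) * (g 1 1 : ℤ) - (g 0 1 : ℤ) * (g 1 0 : ℤ) = 1 := by
    exact_mod_cast hdet
  rw [mem_lattice_periodPair, mem_lattice_periodPair]
  constructor
  · rintro ⟨m, n, h⟩
    refine ⟨g 0 0 * m - g 0 1 * n, g 1 1 * n - g 1 0 * m, ?_⟩
    apply mul_left_cancel₀ hj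
    rw [← h]
    push_cast
    linear_combination (((g 1 1 : ℤ) : ℂ) * n - (g 1 0 : ℤ) * m) * hm + (m + n * τ) * hdet'
  · rintro ⟨m, n, rfl⟩
    refine ⟨g 1 1 * m + g 0 1 * n, g 1 0 * m + g 0 0 * n, ?_⟩
    push_cast
    linear_combination -(n : ℂ) * hm

/-- A matrix trivial modulo `2` preserves the classes of the half periods, and the factor `(cτ +
d)²` cancels in the quotient defining `λ`. -/
lemma modularLambda_sanov_smul {g : SL(2, ℤ)} (hg : g ∈ sanovSubgroup) (τ : ℍ) :
    modularLambda (g • τ : ℍ) = modularLambda τ := by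
  obtain ⟨⟨a, ha⟩, ⟨b, hb⟩, ⟨c, hc⟩, ⟨d, hd⟩⟩ := hg
  rw [sub_eq_iff_eq_add] at ha hd
  have hj := SL_denom_ne_zero g τ
  have hm := SL_smul_mul_denom g τ
  have hom := PeriodPair.weierstrassP_homothety hj (mul_mem_lattice_SL_smul g τ)
  have key : ∀ z w : ℂ, w ∈ τ.periodPair.lattice →
      τ.periodPair.weierstrassP (z + w) = τ.periodPair.weierstrassP z :=
    fun z w hw => τ.periodPair.weierstrassP_add_coe z ⟨w, hw⟩
  have h1 : τ.periodPair.e₁ = (g • τ).periodPair.e₁ / (((g 1 0 : ℤ) : ℂ) * τ + (g 1 1 : ℤ)) ^ 2 := by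
    rw [show (g • τ).periodPair.e₁ = (g • τ).periodPair.weierstrassP (1 / 2) from rfl, ← hom]
    rw [show (((g 1 0 : ℤ) : ℂ) * (τ : ℂ) + (g 1 1 : ℤ)) * (1 / 2) = 1 / 2 + ((2 * d : ℤ) + c * τ) by
      rw [hc, hd]; push_cast; ring, key _ _ (mem_lattice_periodPair.mpr ⟨2 * d, c, rfl⟩)]
    rfl
  have h2 : τ.periodPair.e₂ = (g • τ).periodPair.e₂ / (((g 1 0 : ℤ) : ℂ) * τ + (g 1 1 : ℤ)) ^ 2 := by
    rw [show (g • τ).periodPair.e₂ = (g • τ).periodPair.weierstrassP ((g • τ : ℍ) / 2) from rfl,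
      ← hom]
    rw [show (((g 1 0 : ℤ) : ℂ) * (τ : ℂ) + (g 1 1 : ℤ)) * ((g • τ : ℍ) / 2) =
        τ / 2 + (b + (2 * a : ℤ) * τ) by
      rw [show (((g 1 0 : ℤ) : ℂ) * (τ : ℂ) + (g 1 1 : ℤ)) * ((g • τ : ℍ) / 2) =
        ((g • τ : ℍ) : ℂ) * (((g 1 0 : ℤ) : ℂ) * (τ : ℂ) + (g 1 1 : ℤ)) / 2 by ring, hm, ha, hb]
      push_cast; ring, key _ _ (mem_lattice_periodPair.mpr ⟨b, 2 * a, rfl⟩)]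
    rfl
  have hjz := pow_ne_zero 2 hj
  rw [modularLambda_coe', modularLambda_coe', h1, h2]
  have hne := sub_ne_zero.mpr (g • τ).periodPair.e₁_ne_e₂
  rw [← sub_div, ← mul_div_assoc, ← neg_div, ← sub_div, div_div_div_cancel_right₀ hjz]

/-- Equal `λ` means the same Legendre curve, hence the same scaled lattice. Corresponding half
periods have the same `℘` value and so agree modulo the lattice. The base change is therefore
trivial modulo `2`; orientation gives determinant `1`, and a sign brings it into the Sanov subgroup.
-/
lemma exists_sanov_smul_of_modularLambda_eq {τ τ' : ℍ}
    (h : modularLambda τ = modularLambda τ') : ∃ g ∈ sanovSubgroup, g • τ = τ' := by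
  set α := periodScale τ with hα
  set α' := periodScale τ' with hα'
  have hα0 : α ≠ 0 := periodScale_ne_zero τ.im_pos
  have hα0' : α' ≠ 0 := periodScale_ne_zero τ'.im_pos
  have hlat : τ.scaledPair.lattice = τ'.scaledPair.lattice := by
    rw [← periodLattice_modularLambda, ← periodLattice_modularLambda, h]
  have hP : ∀ z, τ'.scaledPair.weierstrassP z = τ.scaledPair.weierstrassP z := fun z => by
    have := PeriodPair.weierstrassP_homothety (L := τ.scaledPair) (M := τ'.scaledPair) one_ne_zero
      (fun z => by rw [one_mul, hlat]) z
    simpa using this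
  have m1 : α ∈ τ.scaledPair.lattice := τ.scaledPair.ω₁_mem_lattice
  have m2 : α * τ ∈ τ.scaledPair.lattice := τ.scaledPair.ω₂_mem_lattice
  have m1' : α' ∈ τ.scaledPair.lattice := by
    rw [hlat]; exact τ'.scaledPair.ω₁_mem_lattice
  have m2' : α' * τ' ∈ τ.scaledPair.lattice := by
    rw [hlat]; exact τ'.scaledPair.ω₂_mem_lattice
  have n1 : α / 2 ∉ τ.scaledPair.lattice := τ.scaledPair.ω₁_div_two_notMem_lattice
  have n2 : α * τ / 2 ∉ τ.scaledPair.lattice := τ.scaledPair.ω₂_div_two_notMem_lattice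
  have n1' : α' / 2 ∉ τ.scaledPair.lattice := by
    rw [hlat]; exact τ'.scaledPair.ω₁_div_two_notMem_lattice
  have n2' : α' * τ' / 2 ∉ τ.scaledPair.lattice := by
    rw [hlat]; exact τ'.scaledPair.ω₂_div_two_notMem_lattice
  have s1 := τ.scaledPair.sub_mem_lattice_of_weierstrassP_eq n1' n1
    (by rw [← hP, e₁_scaledPair, e₁_scaledPair, h])
    (by rw [PeriodPair.derivWeierstrassP_half _ m1, PeriodPair.derivWeierstrassP_half _ m1'])
  have s2 := τ.scaledPair.sub_mem_lattice_of_weierstrassP_eq n2' n2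
    (by rw [← hP, e₂_scaledPair, e₂_scaledPair, h])
    (by rw [PeriodPair.derivWeierstrassP_half _ m2, PeriodPair.derivWeierstrassP_half _ m2'])
  obtain ⟨m, n, hmn⟩ := mem_lattice_scaledPair.mp s1
  obtain ⟨k, l, hkl⟩ := mem_lattice_scaledPair.mp s2
  rw [hlat] at m1 m2
  obtain ⟨p, q, hpq⟩ := mem_lattice_scaledPair.mp m1
  obtain ⟨r, s, hrs⟩ := mem_lattice_scaledPair.mp m2
  rw [← hα] at hmn hkl
  rw [← hα'] at hpq hrs
  have r1 : α' = α * (((1 + 2 * m : ℤ) : ℂ) + (2 * n : ℤ) * τ) := by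
    push_cast; linear_combination -2 * hmn
  have r2 : α' * τ' = α * (((2 * k : ℤ) : ℂ) + (1 + 2 * l : ℤ) * τ) := by
    push_cast; linear_combination -2 * hkl
  have q1 := intCast_add_mul_inj (τ := τ) (m := p * (1 + 2 * m) + q * (2 * k))
    (n := p * (2 * n) + q * (1 + 2 * l)) (m' := 1) (n' := 0) (by
      apply mul_left_cancel₀ hα0
      push_cast at r1 r2 ⊢
      linear_combination hpq - p * r1 - q * r2)
  have q2 := intCast_add_mul_inj (τ := τ) (m := r * (1 + 2 * m) + s * (2 * k))
    (n := r * (2 * n) + s * (1 + 2 * l)) (m' := 0) (n' := 1) (by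
      apply mul_left_cancel₀ hα0
      push_cast at r1 r2 ⊢
      linear_combination hrs - r * r1 - s * r2)
  set D : ℤ := (1 + 2 * l) * (1 + 2 * m) - (2 * k) * (2 * n) with hD
  -- The base changes in the two directions are inverse, so their integer determinants multiply to
  -- `1`.
  have hunit : D * (p * s - q * r) = 1 := by
    obtain ⟨a1, a2⟩ := q1
    obtain ⟨b1, b2⟩ := q2
    linear_combination (r * (2 * n) + s * (1 + 2 * l)) * a1 + b2 -
      (r * (1 + 2 * m) + s * (2 * k)) * a2
  have hrel : (τ' : ℂ) * ((2 * n : ℤ) * τ + (1 + 2 * m : ℤ)) =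
      (1 + 2 * l : ℤ) * τ + (2 * k : ℤ) := by
    apply mul_left_cancel₀ hα0
    linear_combination r2 - τ' * r1
  -- Both `τ` and `τ'` lie in the upper half plane, so the base change preserves orientation.
  have hDpos : 0 < D := by
    have hre := congrArg Complex.re hrel
    have him := congrArg Complex.im hrel
    simp only [Complex.mul_re, Complex.mul_im, Complex.add_re, Complex.add_im, Complex.intCast_re,
      Complex.intCast_im, UpperHalfPlane.coe_re, UpperHalfPlane.coe_im, zero_mul, sub_zero,
      add_zero] at hre him
    have e : τ'.im * (((2 * n : ℤ) * τ.re + (1 + 2 * m : ℤ)) ^ 2 + ((2 * n : ℤ) * τ.im) ^ 2) =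
        (D : ℝ) * τ.im := by
      rw [hD]
      push_cast at hre him ⊢
      linear_combination (2 * (n : ℝ) * τ.re + (1 + 2 * m)) * him - (2 * (n : ℝ) * τ.im) * hre
    have h1 : 0 ≤ (D : ℝ) * τ.im := by
      rw [← e]
      have := τ'.im_pos
      positivity
    have h2 : 0 ≤ (D : ℝ) := nonneg_of_mul_nonneg_left h1 τ.im_pos
    have h3 : 0 ≤ D := by exact_mod_cast h2
    rcases h3.lt_or_eq with h | h
    · exact h
    · rw [← h] at hunit; simp at hunit
  have hD1 : D = 1 := by
    rcases Int.isUnit_iff.mp (IsUnit.of_mul_eq_one _ hunit) with h | h <;> omega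
  set g : SL(2, ℤ) := ⟨!![1 + 2 * l, 2 * k; 2 * n, 1 + 2 * m], by
    rw [Matrix.det_fin_two_of]; linear_combination hD1⟩ with hg
  have hgτ : g • τ = τ' := by
    apply UpperHalfPlane.ext
    have hm := SL_smul_mul_denom g τ
    apply mul_right_cancel₀ (SL_denom_ne_zero g τ)
    rw [hm]
    exact hrel.symm
  -- Determinant `1` makes `l + m` even, so the diagonal entries are both `1` or both `3` modulo
  -- `4`; in the second case `-g` is the required matrix.
  have hodd : (1 + 2 * l) * (1 + 2 * m) = 1 + 4 * (k * n) := by linear_combination hD1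
  have hpar : 4 * (l * m) + 2 * (l + m) = 4 * (k * n) := by linear_combination hodd
  rcases Int.even_or_odd l with ⟨l', hl'⟩ | ⟨l', hl'⟩
  · refine ⟨g, ?_, hgτ⟩
    rw [mem_sanovSubgroup]
    simp only [hg, Matrix.SpecialLinearGroup.coe_mk, Matrix.of_apply, Matrix.cons_val',
      Matrix.cons_val_zero, Matrix.cons_val_one, Matrix.cons_val_fin_one]
    refine ⟨⟨l', by omega⟩, ⟨k, rfl⟩, ⟨n, rfl⟩, ?_⟩
    have : 2 ∣ m := by omega
    omega
  · refine ⟨-g, ?_, by rw [neg_SL_smul, hgτ]⟩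
    rw [mem_sanovSubgroup]
    have e00 : (-g) 0 0 = -(1 + 2 * l) := rfl
    have e01 : (-g) 0 1 = -(2 * k) := rfl
    have e10 : (-g) 1 0 = -(2 * n) := rfl
    have e11 : (-g) 1 1 = -(1 + 2 * m) := rfl
    rw [e00, e01, e10, e11]
    refine ⟨⟨-(l' + 1), by omega⟩, ⟨-k, by ring⟩, ⟨-n, by ring⟩, ?_⟩
    have : 2 ∣ m + 1 := by omega
    omega

lemma modularLambda_eq_iff {τ τ' : ℍ} :
    modularLambda τ = modularLambda τ' ↔ ∃ g ∈ sanovSubgroup, g • τ = τ' := by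
  refine ⟨exists_sanov_smul_of_modularLambda_eq, ?_⟩
  rintro ⟨g, hg, rfl⟩
  exact (modularLambda_sanov_smul hg τ).symm

end

noncomputable section

open Filter Topology UpperHalfPlane

open scoped MatrixGroups

/-! ### The action of the Sanov subgroup on the upper half plane -/

lemma UpperHalfPlane.continuous_SL_smul (g : SL(2, ℤ)) : Continuous fun τ : ℍ => g • τ := by
  rw [UpperHalfPlane.isEmbedding_coe.continuous_iff]
  have : (UpperHalfPlane.coe ∘ fun τ : ℍ => g • τ) =
      fun τ : ℍ => ((g 0 0 : ℤ) * (τ : ℂ) + (g 0 1 : ℤ)) / ((g 1 0 : ℤ) * τ + (g 1 1 : ℤ)) := by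
    ext τ
    exact eq_div_of_mul_eq (SL_denom_ne_zero g τ) (SL_smul_mul_denom g τ)
  rw [this]
  exact Continuous.div (by fun_prop) (by fun_prop) fun τ => SL_denom_ne_zero g τ

instance : ContinuousConstSMul sanovSubgroup ℍ :=
  ⟨fun g => continuous_SL_smul g.1⟩

instance : ProperlyDiscontinuousSMul sanovSubgroup ℍ := by
  constructor
  intro K L hK hL
  let f : sanovSubgroup → 𝒮ℒ := fun g => ⟨(g.1 : GL (Fin 2) ℝ), ⟨g.1, rfl⟩⟩
  have hf : Function.Injective f := by
    intro g h e
    have e' : (g.1 : GL (Fin 2) ℝ) = (h.1 : GL (Fin 2) ℝ) := congrArg Subtype.val e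
    apply Subtype.ext
    ext i j
    have := congrArg (fun x : GL (Fin 2) ℝ => x.1 i j) e'
    simpa using this
  refine (Set.Finite.preimage hf.injOn
    (ProperlyDiscontinuousSMul.finite_disjoint_inter_image (Γ := 𝒮ℒ) hK hL)).subset ?_
  rintro g ⟨_, ⟨x, hx, rfl⟩, hL⟩
  exact ⟨_, ⟨x, hx, rfl⟩, hL⟩

/-- A fixed point `x + iy` gives `(tr g)² + 4c²y² = 4`. As `tr g ≡ 2` modulo `4`, the trace is `±2`
and `c = 0`; the congruences on the diagonal then exclude `-1`. -/
lemma eq_one_of_sanov_smul_eq {g : SL(2, ℤ)} (hg : g ∈ sanovSubgroup) {τ : ℍ} (h : g • τ = τ) :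
    g = 1 := by
  obtain ⟨⟨a, ha⟩, ⟨b, hb⟩, ⟨c, hc⟩, ⟨d, hd⟩⟩ := hg
  have hm := SL_smul_mul_denom g τ
  rw [h] at hm
  have hdet := g.det_coe
  rw [Matrix.det_fin_two] at hdet
  have hre := congrArg Complex.re hm
  have him := congrArg Complex.im hm
  simp only [Complex.mul_re, Complex.mul_im, Complex.add_re, Complex.add_im, Complex.intCast_re,
    Complex.intCast_im, UpperHalfPlane.coe_re, UpperHalfPlane.coe_im, zero_mul, sub_zero,
    add_zero] at hre him
  have hy := τ.im_pos
  have h1 : 2 * (g 1 0 : ℝ) * τ.re + (g 1 1 : ℤ) - (g 0 0 : ℤ) = 0 := by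
    apply (mul_eq_zero.mp _).resolve_left hy.ne'
    linear_combination him
  have htr : ((g 0 0 : ℝ) + (g 1 1 : ℤ)) ^ 2 + 4 * (g 1 0 : ℝ) ^ 2 * τ.im ^ 2 = 4 := by
    have hdet' : (g 0 0 : ℝ) * (g 1 1 : ℤ) - (g 0 1 : ℤ) * (g 1 0 : ℤ) = 1 := by exact_mod_cast hdet
    linear_combination 4 * hdet' - 4 * (g 1 0 : ℝ) * hre +
      (2 * (g 1 0 : ℝ) * τ.re + (g 1 1 : ℤ) - (g 0 0 : ℤ)) * h1
  have hle : (g 0 0 + g 1 1) ^ 2 ≤ 4 := by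
    have : ((g 0 0 : ℝ) + (g 1 1 : ℤ)) ^ 2 ≤ 4 := by nlinarith [sq_nonneg ((g 1 0 : ℝ) * τ.im)]
    exact_mod_cast this
  have hle2 : g 0 0 + g 1 1 ≤ 2 := by nlinarith
  have hge2 : -2 ≤ g 0 0 + g 1 1 := by nlinarith
  have hc0 : g 1 0 = 0 := by
    have : ((g 0 0 : ℝ) + (g 1 1 : ℤ)) ^ 2 = 4 := by
      have : (g 0 0 + g 1 1) ^ 2 = 4 := by
        rcases (by omega : g 0 0 + g 1 1 = 2 ∨ g 0 0 + g 1 1 = -2) with h | h <;> rw [h] <;> norm_num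
      exact_mod_cast this
    have : (g 1 0 : ℝ) ^ 2 * τ.im ^ 2 = 0 := by linarith
    have := (mul_eq_zero.mp this).resolve_right (pow_ne_zero 2 hy.ne')
    exact_mod_cast pow_eq_zero_iff (two_ne_zero) |>.mp this
  rw [hc0, mul_zero, sub_zero] at hdet
  have ha1 : g 0 0 = 1 := by
    rcases Int.isUnit_iff.mp (IsUnit.of_mul_eq_one _ hdet) with h | h <;> omega
  have hd1 : g 1 1 = 1 := by rw [ha1, one_mul] at hdet; exact hdet
  have hb0 : g 0 1 = 0 := by
    rw [hc0, ha1, hd1] at him hre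
    have : (g 0 1 : ℝ) = 0 := by simpa using hre
    exact_mod_cast this
  ext i j
  fin_cases i <;> fin_cases j <;> simp [ha1, hb0, hc0, hd1]

instance : IsCancelSMul sanovSubgroup ℍ :=
  isCancelSMul_iff_eq_one_of_smul_eq.mpr fun g _ h => Subtype.ext (eq_one_of_sanov_smul_eq g.2 h)

/-! ### Local behaviour of `λ` -/

lemma analyticAt_modularLambda {z : ℂ} (hz : 0 < z.im) : AnalyticAt ℂ modularLambda z :=
  differentiableOn_modularLambda.analyticAt (isOpen_im_pos.mem_nhds hz)

lemma exists_injOn_modularLambda (τ : ℍ) : ∃ U ∈ 𝓝 (τ : ℂ), U ⊆ {z | 0 < z.im} ∧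
    Set.InjOn modularLambda U := by
  obtain ⟨V, hV, hVg⟩ :=
    ProperlyDiscontinuousSMul.exists_nhds_image_smul_eq_self sanovSubgroup τ
  refine ⟨UpperHalfPlane.coe '' V, UpperHalfPlane.isOpenEmbedding_coe.image_mem_nhds.mpr hV, ?_, ?_⟩
  · rintro _ ⟨ξ, -, rfl⟩
    exact ξ.im_pos
  · rintro _ ⟨ξ, hξ, rfl⟩ _ ⟨ξ', hξ', rfl⟩ h
    obtain ⟨g, hg, rfl⟩ := modularLambda_eq_iff.mp h
    have := hVg ⟨g, hg⟩ ⟨_, ⟨ξ, hξ, rfl⟩, hξ'⟩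
    rw [eq_one_of_sanov_smul_eq hg this, one_smul]

lemma not_eventually_modularLambda_eq {z : ℂ} (hz : 0 < z.im) :
    ¬ ∀ᶠ w in 𝓝 z, modularLambda w = modularLambda z := by
  intro h
  obtain ⟨U, hU, -, hinj⟩ := exists_injOn_modularLambda ⟨z, hz⟩
  have h2 : ∀ᶠ w in 𝓝 z, w = z := by
    filter_upwards [h, hU] with w hw hwU
    exact hinj hwU (mem_of_mem_nhds hU) hw
  have h3 : ∀ᶠ w in 𝓝[≠] z, w = z := h2.filter_mono nhdsWithin_le_nhds
  obtain ⟨w, hw, hne⟩ := (h3.and self_mem_nhdsWithin).exists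
  exact hne hw

lemma nhds_le_map_modularLambda {z : ℂ} (hz : 0 < z.im) :
    𝓝 (modularLambda z) ≤ map modularLambda (𝓝 z) :=
  (analyticAt_modularLambda hz).eventually_constant_or_nhds_le_map_nhds.resolve_left
    (not_eventually_modularLambda_eq hz)

/-- An injective holomorphic function has nonvanishing derivative. -/
lemma AnalyticAt.deriv_ne_zero_of_injOn {f : ℂ → ℂ} {z : ℂ} (hf : AnalyticAt ℂ f z) {U : Set ℂ}
    (hU : U ∈ 𝓝 z) (hinj : Set.InjOn f U) : deriv f z ≠ 0 := by
  intro h0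
  have hnc : ∀ w, w ∈ interior U → ¬ ∀ᶠ x in 𝓝 w, f x = f w := by
    intro w hw h
    have h2 : ∀ᶠ x in 𝓝 w, x = w := by
      filter_upwards [h, mem_interior_iff_mem_nhds.mp hw] with x hx hxU
      exact hinj hxU (interior_subset hw) hx
    obtain ⟨x, hx, hne⟩ := ((h2.filter_mono nhdsWithin_le_nhds).and
      (self_mem_nhdsWithin : {w}ᶜ ∈ 𝓝[≠] w)).exists
    exact hne hx
  -- a ball on which `f` is analytic, injective and has no critical point but the centre
  have hd : ∀ᶠ w in 𝓝[≠] z, deriv f w ≠ 0 := by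
    rcases hf.deriv.eventually_eq_zero_or_eventually_ne_zero with h | h
    · exfalso
      obtain ⟨r, hr, hball⟩ := Metric.eventually_nhds_iff_ball.mp (h.and hf.eventually_analyticAt)
      apply hnc z (mem_interior_iff_mem_nhds.mpr hU)
      filter_upwards [Metric.ball_mem_nhds z hr] with w hw
      exact Metric.isOpen_ball.is_const_of_deriv_eq_zero
        (convex_ball z r).isPreconnected
        (fun x hx => (hball x hx).2.differentiableAt.differentiableWithinAt)
        (fun x hx => (hball x hx).1) hw (Metric.mem_ball_self hr)
    · exact h
  obtain ⟨r, hr, hball⟩ := Metric.eventually_nhds_iff_ball.mp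
    ((eventually_nhdsWithin_iff.mp hd).and (hf.eventually_analyticAt.and hU))
  have hBU : Metric.ball z r ⊆ U := fun x hx => (hball x hx).2.2
  have hBI : Metric.ball z r ⊆ interior U := Metric.isOpen_ball.subset_interior_iff.mpr hBU
  set V := f '' Metric.ball z r with hV
  have hopen : ∀ O ⊆ Metric.ball z r, IsOpen O → IsOpen (f '' O) := by
    intro O hO hOo
    rw [isOpen_iff_mem_nhds]
    rintro _ ⟨w, hw, rfl⟩
    exact ((hball w (hO hw)).2.1.eventually_constant_or_nhds_le_map_nhds.resolve_left
      (hnc w (hBI (hO hw)))) (image_mem_map (hOo.mem_nhds hw))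
  let ξ := Function.invFunOn f (Metric.ball z r)
  have hξ : ∀ w ∈ Metric.ball z r, ξ (f w) = w := fun w hw =>
    (hinj.mono hBU) (Function.invFunOn_mem ⟨w, hw, rfl⟩) hw
      (Function.invFunOn_eq (f := f) (s := Metric.ball z r) ⟨w, hw, rfl⟩)
  have hVo : IsOpen V := hopen _ le_rfl Metric.isOpen_ball
  have hfξ : ∀ v ∈ V, f (ξ v) = v := by
    rintro _ ⟨w, hw, rfl⟩
    rw [hξ w hw]
  have hξc : ∀ v ∈ V, ContinuousAt ξ v := by
    rintro _ ⟨w, hw, rfl⟩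
    rw [ContinuousAt, hξ w hw, tendsto_def]
    intro O hO
    have : f '' (interior O ∩ Metric.ball z r) ∈ 𝓝 (f w) :=
      (hopen _ Set.inter_subset_right (isOpen_interior.inter Metric.isOpen_ball)).mem_nhds
        ⟨w, ⟨mem_interior_iff_mem_nhds.mpr hO, hw⟩, rfl⟩
    filter_upwards [this]
    rintro _ ⟨x, ⟨hx, hxb⟩, rfl⟩
    rw [Set.mem_preimage, hξ x hxb]
    exact interior_subset hx
  have hzV : f z ∈ V := ⟨z, Metric.mem_ball_self hr, rfl⟩
  have hξd : ∀ v ∈ V \ {f z}, DifferentiableAt ℂ ξ v := by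
    rintro _ ⟨⟨w, hw, rfl⟩, hne⟩
    have hwz : w ≠ z := fun h => hne (by rw [h]; rfl)
    have hd : HasDerivAt f (deriv f w) (ξ (f w)) := by
      rw [hξ w hw]
      exact (hball w hw).2.1.differentiableAt.hasDerivAt
    exact (hd.of_local_left_inverse (hξc _ ⟨w, hw, rfl⟩) ((hball w hw).1 hwz)
      (by filter_upwards [hVo.mem_nhds ⟨w, hw, rfl⟩] with v hv using hfξ v hv)).differentiableAt
  -- The inverse is continuous at the possible critical value and holomorphic elsewhere, so the
  -- singularity is removable; the chain rule then contradicts `f'(z) = 0`.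
  have hξz : DifferentiableAt ℂ ξ (f z) :=
    ((Complex.differentiableOn_compl_singleton_and_continuousAt_iff (hVo.mem_nhds hzV)).mp
      ⟨fun v hv => (hξd v hv).differentiableWithinAt, hξc _ hzV⟩).differentiableAt
      (hVo.mem_nhds hzV)
  have hcomp : HasDerivAt (f ∘ ξ) (deriv f z * deriv ξ (f z)) (f z) := by
    apply HasDerivAt.comp
    · rw [hξ z (Metric.mem_ball_self hr)]
      exact hf.differentiableAt.hasDerivAt
    · exact hξz.hasDerivAt
  have hid : HasDerivAt (f ∘ ξ) 1 (f z) := by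
    apply (hasDerivAt_id (f z)).congr_of_eventuallyEq
    filter_upwards [hVo.mem_nhds hzV] with v hv using hfξ v hv
  have := hcomp.unique hid
  rw [h0, zero_mul] at this
  exact zero_ne_one this

lemma deriv_modularLambda_ne_zero {z : ℂ} (hz : 0 < z.im) : deriv modularLambda z ≠ 0 := by
  obtain ⟨U, hU, -, hinj⟩ := exists_injOn_modularLambda ⟨z, hz⟩
  exact (analyticAt_modularLambda hz).deriv_ne_zero_of_injOn hU hinj

/-! ### Behaviour at the cusp `i∞` -/

open EisensteinSeries ModularForm ModularFormClass

lemma tendsto_E_atImInfty {k : ℕ} (hk : 3 ≤ k) (hk2 : Even k) :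
    Tendsto (fun τ : ℍ => E hk τ) atImInfty (𝓝 1) := by
  have hc := E_qExpansion_coeff_zero hk hk2
  have han : AnalyticAt ℂ (cuspFunction 1 (E hk)) 0 :=
    ModularFormClass.analyticAt_cuspFunction_zero (E hk) one_pos one_mem_strictPeriods_SL
  have hper := SlashInvariantFormClass.periodic_comp_ofComplex (E hk) one_mem_strictPeriods_SL
  rw [UpperHalfPlane.qExpansion_coeff_zero one_pos han hper] at hc
  obtain ⟨c, hc0, hO⟩ := exp_decay_sub_atImInfty' (E hk)
  rw [hc] at hO
  have h0 : Tendsto (fun τ : ℍ => Real.exp (-c * τ.im)) atImInfty (𝓝 0) := by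
    apply Real.tendsto_exp_atBot.comp
    have : Tendsto (fun τ : ℍ => τ.im) atImInfty atTop := tendsto_comap
    simp only [neg_mul]
    exact tendsto_neg_atTop_atBot.comp (this.const_mul_atTop hc0)
  simpa using (hO.trans_tendsto h0).add_const 1

lemma G_periodPair {k : ℕ} (hk : 3 ≤ k) (τ : ℍ) :
    τ.periodPair.G k = 2 * riemannZeta k * E hk τ := by
  have h1 : E hk τ = 1 / 2 * eisensteinSeries (N := 1) 0 k τ := rfl
  rw [h1, PeriodPair.G, ← τ.latticeParam.tsum_eq]
  have h2 := tsum_eisSummand_eq_riemannZeta_mul_eisensteinSeries hk τ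
  rw [show 2 * riemannZeta k * (1 / 2 * eisensteinSeries (N := 1) 0 k τ) =
    riemannZeta k * eisensteinSeries (N := 1) 0 k τ by ring, ← h2]
  refine tsum_congr fun v => ?_
  rw [latticeParam_apply, eisSummand, zpow_neg, zpow_natCast]

lemma bernoulli'_six : bernoulli' 6 = 1 / 42 := by
  have h5 : bernoulli' 5 = 0 := by
    rw [bernoulli'_def]
    norm_num [Finset.sum_range_succ, Nat.choose, bernoulli'_zero, bernoulli'_one, bernoulli'_two,
      bernoulli'_three, bernoulli'_four]
  rw [bernoulli'_def]
  norm_num [Finset.sum_range_succ, Nat.choose, bernoulli'_zero, bernoulli'_one, bernoulli'_two,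
    bernoulli'_three, bernoulli'_four, h5]

lemma riemannZeta_six : riemannZeta 6 = (Real.pi : ℂ) ^ 6 / 945 := by
  have := riemannZeta_two_mul_nat (k := 3) (by norm_num)
  rw [show (2 * ((3 : ℕ) : ℂ)) = 6 by norm_num, show 2 * 3 = 6 from rfl,
    bernoulli_eq_bernoulli'_of_ne_one (by norm_num), bernoulli'_six] at this
  rw [this]
  norm_num [Nat.factorial]
  ring

lemma g₂_periodPair (τ : ℍ) : τ.periodPair.g₂ = 4 * Real.pi ^ 4 / 3 * E₄ τ := by
  rw [PeriodPair.g₂, G_periodPair (by norm_num : 3 ≤ 4)]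
  push_cast
  rw [riemannZeta_four]
  ring

lemma g₃_periodPair (τ : ℍ) : τ.periodPair.g₃ = 8 * Real.pi ^ 6 / 27 * E₆ τ := by
  rw [PeriodPair.g₃, G_periodPair (by norm_num : 3 ≤ 6)]
  push_cast
  rw [riemannZeta_six]
  ring

lemma tendsto_g₂_periodPair : Tendsto (fun τ : ℍ => τ.periodPair.g₂) atImInfty
    (𝓝 (4 * Real.pi ^ 4 / 3)) := by
  simp only [g₂_periodPair]
  simpa using (tendsto_E_atImInfty (by norm_num : 3 ≤ 4) ⟨2, rfl⟩).const_mul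
    (4 * (Real.pi : ℂ) ^ 4 / 3)

/-- The discriminant is a multiple of `E₄³ - E₆²`, and both Eisenstein series tend to `1`. -/
lemma tendsto_discr_periodPair : Tendsto (fun τ : ℍ => τ.periodPair.g₂ ^ 3 -
    27 * τ.periodPair.g₃ ^ 2) atImInfty (𝓝 0) := by
  have h4 := (tendsto_E_atImInfty (by norm_num : 3 ≤ 4) ⟨2, rfl⟩).pow 3
  have h6 := (tendsto_E_atImInfty (by norm_num : 3 ≤ 6) ⟨3, rfl⟩).pow 2
  have := (h4.sub h6).const_mul (64 * (Real.pi : ℂ) ^ 12 / 27)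
  simp only [one_pow, sub_self, mul_zero] at this
  refine this.congr fun τ => ?_
  rw [g₂_periodPair, g₃_periodPair]
  ring

/-! ### Surjectivity of `λ` -/

/-- The quotient `(g₂³ - 27g₃²)/g₂³` is invariant under homothety. Compared with its value on the
Legendre lattice, it gives this identity, free of denominators. -/
lemma discr_relation (γ : SL(2, ℤ)) (τ : ℍ) :
    ((γ • τ).periodPair.g₂ ^ 3 - 27 * (γ • τ).periodPair.g₃ ^ 2) *
      (4 * (modularLambda τ ^ 2 - modularLambda τ + 1) ^ 3) =
    (γ • τ).periodPair.g₂ ^ 3 * (27 * modularLambda τ ^ 2 * (1 - modularLambda τ) ^ 2) := by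
  have hj := SL_denom_ne_zero γ τ
  have ha := periodScale_ne_zero τ.im_pos
  have e2 := PeriodPair.g₂_homothety hj (mul_mem_lattice_SL_smul γ τ)
  have e3 := PeriodPair.g₃_homothety hj (mul_mem_lattice_SL_smul γ τ)
  have f2 := PeriodPair.g₂_homothety ha τ.mul_mem_lattice_scaledPair
  have f3 := PeriodPair.g₃_homothety ha τ.mul_mem_lattice_scaledPair
  obtain ⟨h2, h3⟩ := (PeriodPair.uniformizesLegendre_iff _ _).mp (uniformizesLegendre_scaledPair τ)
  rw [eq_div_iff (pow_ne_zero _ hj)] at e2 e3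
  rw [eq_div_iff (pow_ne_zero _ ha)] at f2 f3
  rw [← e2, ← e3, ← f2, ← f3, h2, h3]
  ring

instance : Finite (SL(2, ℤ) ⧸ sanovSubgroup) := by
  have hle : CongruenceSubgroup.Gamma 4 ≤ sanovSubgroup := by
    intro g hg
    rw [CongruenceSubgroup.Gamma_mem] at hg
    obtain ⟨h00, h01, h10, h11⟩ := hg
    rw [ZMod.intCast_zmod_eq_zero_iff_dvd _ 4] at h01 h10
    refine ⟨(ZMod.intCast_zmod_eq_zero_iff_dvd _ 4).mp (by push_cast; rw [h00]; simp), ?_, ?_,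
      (ZMod.intCast_zmod_eq_zero_iff_dvd _ 4).mp (by push_cast; rw [h11]; simp)⟩
    · exact dvd_trans (by norm_num) h01
    · exact dvd_trans (by norm_num) h10
  have := Subgroup.finiteIndex_of_le hle
  infer_instance

/-- For values of `λ` near `l ≠ 0, 1`, `discr_relation` keeps `(g₂³ - 27g₃²)/g₂³` away from `0`, its
limit at the cusp. So a translate of `τ` in the fundamental domain has bounded height, and the
values near `l` come from a compact set and finitely many cosets. -/
lemma isClosed_range_modularLambda {l : ℂ} (hl : l ∈ legendreBase)
    (h : l ∈ closure (Set.range fun τ : ℍ => modularLambda τ)) :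
    l ∈ Set.range fun τ : ℍ => modularLambda τ := by
  -- a height above which no translate of a point with `λ` near `l` can lie
  have hpos : 0 < ‖27 * l ^ 2 * (1 - l) ^ 2‖ := by
    rw [norm_pos_iff]
    exact mul_ne_zero (mul_ne_zero (by norm_num) (pow_ne_zero 2 hl.1))
      (pow_ne_zero 2 (sub_ne_zero.mpr hl.2.symm))
  obtain ⟨m, hm0, hm⟩ := exists_between hpos
  obtain ⟨M, hM⟩ := exists_gt ‖4 * (l ^ 2 - l + 1) ^ 3‖
  have hV : ∀ᶠ w in 𝓝 l, m < ‖27 * w ^ 2 * (1 - w) ^ 2‖ ∧ ‖4 * (w ^ 2 - w + 1) ^ 3‖ < M :=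
    ((by fun_prop : ContinuousAt (fun w : ℂ => ‖27 * w ^ 2 * (1 - w) ^ 2‖) l).eventually
      (lt_mem_nhds hm)).and
    ((by fun_prop : ContinuousAt (fun w : ℂ => ‖4 * (w ^ 2 - w + 1) ^ 3‖) l).eventually
      (gt_mem_nhds hM))
  have hM0 : 0 < M := (norm_nonneg _).trans_lt hM
  have hT : ∀ᶠ ξ : ℍ in atImInfty, ‖ξ.periodPair.g₂ ^ 3 - 27 * ξ.periodPair.g₃ ^ 2‖ * M <
      ‖ξ.periodPair.g₂ ^ 3‖ * m := by
    apply Tendsto.eventually_lt (tendsto_discr_periodPair.norm.mul_const M)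
      ((tendsto_g₂_periodPair.pow 3).norm.mul_const m)
    rw [norm_zero, zero_mul]
    apply mul_pos _ hm0
    rw [norm_pos_iff]
    exact pow_ne_zero 3 (div_ne_zero (mul_ne_zero (by norm_num)
      (pow_ne_zero 4 (by exact_mod_cast Real.pi_ne_zero))) (by norm_num))
  obtain ⟨Y, hY⟩ := (atImInfty_mem _).mp hT
  set K : Set ℍ := {ξ | |ξ.re| ≤ 1 / 2 ∧ 1 / 2 ≤ ξ.im ∧ ξ.im ≤ Y} with hK
  have hKc : IsCompact K := by
    rw [UpperHalfPlane.isEmbedding_coe.isCompact_iff]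
    have : UpperHalfPlane.coe '' K =
        (Set.Icc (-(1 / 2)) (1 / 2) : Set ℝ) ×ℂ (Set.Icc (1 / 2) Y : Set ℝ) := by
      ext z
      rw [Complex.mem_reProdIm, Set.mem_Icc, Set.mem_Icc]
      constructor
      · rintro ⟨ξ, ⟨h1, h2, h3⟩, rfl⟩
        exact ⟨abs_le.mp h1, h2, h3⟩
      · rintro ⟨h1, h2, h3⟩
        have : 0 < z.im := by linarith
        exact ⟨⟨z, this⟩, ⟨abs_le.mpr h1, h2, h3⟩, rfl⟩
    rw [this]
    exact isCompact_Icc.reProdIm isCompact_Icc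
  have hcont : Continuous fun τ : ℍ => modularLambda τ :=
    differentiableOn_modularLambda.continuousOn.comp_continuous UpperHalfPlane.continuous_coe
      fun τ => τ.im_pos
  set C : Set ℂ := ⋃ q : SL(2, ℤ) ⧸ sanovSubgroup,
    (fun ξ : ℍ => modularLambda (q.out⁻¹ • ξ : ℍ)) '' K with hC
  have hCc : IsCompact C := isCompact_iUnion fun q =>
    hKc.image (hcont.comp (continuous_SL_smul _))
  have hsub : Set.range (fun τ : ℍ => modularLambda τ) ∩
      {w | m < ‖27 * w ^ 2 * (1 - w) ^ 2‖ ∧ ‖4 * (w ^ 2 - w + 1) ^ 3‖ < M} ⊆ C := by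
    rintro _ ⟨⟨τ, rfl⟩, hw1, hw2⟩
    obtain ⟨γ, hγ⟩ := ModularGroup.exists_smul_mem_fd τ
    have him := ModularGroup.three_le_four_mul_im_sq_of_mem_fd hγ
    have hp := (γ • τ).im_pos
    rw [hC, Set.mem_iUnion]
    refine ⟨(γ : SL(2, ℤ) ⧸ sanovSubgroup), γ • τ, ⟨hγ.2, by nlinarith, ?_⟩, ?_⟩
    · by_contra! hlt
      have h1 := hY (γ • τ) hlt.le
      have h2 := congrArg norm (discr_relation γ τ)
      rw [norm_mul, norm_mul (_ ^ 3) (27 * _ * _)] at h2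
      beta_reduce at hw1 hw2
      have h3 := mul_le_mul_of_nonneg_left hw2.le
        (norm_nonneg ((γ • τ).periodPair.g₂ ^ 3 - 27 * (γ • τ).periodPair.g₃ ^ 2))
      have h4 := mul_le_mul_of_nonneg_left hw1.le (norm_nonneg ((γ • τ).periodPair.g₂ ^ 3))
      simp only [Set.mem_ofPred_eq] at h1
      linarith
    -- The chosen representative is `γh` with `h` in the Sanov subgroup, so undoing it on `γτ` gives
    -- `h⁻¹τ`, where `λ` is the same.
    · obtain ⟨h, hh⟩ := QuotientGroup.mk_out_eq_mul sanovSubgroup γ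
      simp only
      rw [hh, mul_inv_rev, mul_smul, inv_smul_smul]
      exact modularLambda_sanov_smul (inv_mem h.2) τ
  have hl2 : l ∈ closure C := by
    rw [mem_closure_iff_nhds] at h ⊢
    intro t ht
    obtain ⟨w, ⟨hwt, hwV⟩, hwr⟩ := h _ (inter_mem ht hV)
    exact ⟨w, hwt, hsub ⟨hwr, hwV⟩⟩
  rw [hCc.isClosed.closure_eq, hC, Set.mem_iUnion] at hl2
  obtain ⟨q, ξ, -, hξ⟩ := hl2
  exact ⟨_, hξ⟩

lemma isPreconnected_legendreBase : IsPreconnected legendreBase := by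
  have : legendreBase = ({0, 1} : Set ℂ)ᶜ := by
    ext z
    simp [legendreBase]
  rw [this]
  apply IsConnected.isPreconnected
  apply Set.Countable.isConnected_compl_of_one_lt_rank
  · rw [Complex.rank_real_complex]; norm_num
  · exact ((Set.finite_singleton _).insert _).countable

lemma isOpen_range_modularLambda : IsOpen (Set.range fun τ : ℍ => modularLambda τ) := by
  rw [isOpen_iff_mem_nhds]
  rintro _ ⟨τ, rfl⟩
  refine mem_of_superset (nhds_le_map_modularLambda τ.im_pos
    (image_mem_map (isOpen_im_pos.mem_nhds τ.im_pos))) ?_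
  rintro _ ⟨z, hz, rfl⟩
  exact ⟨⟨z, hz⟩, rfl⟩

/-- The image of `λ` is nonempty, open and relatively closed in the connected `S`. -/
lemma exists_modularLambda_eq {l : ℂ} (hl : l ∈ legendreBase) : ∃ τ : ℍ, modularLambda τ = l := by
  have := isPreconnected_legendreBase.subset_of_closure_inter_subset isOpen_range_modularLambda
    ⟨modularLambda UpperHalfPlane.I, modularLambda_mem _, ⟨_, rfl⟩⟩
    fun l hl => isClosed_range_modularLambda hl.2 hl.1
  exact this hl

/-! ### The covering `λ : ℍ → S` -/

/-- The modular function as a map to the base of the Legendre family. -/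
def lambdaMap (τ : ℍ) : legendreBase := ⟨modularLambda τ, modularLambda_mem τ⟩

@[simp]
lemma coe_lambdaMap (τ : ℍ) : (lambdaMap τ : ℂ) = modularLambda τ := rfl

lemma continuous_lambdaMap : Continuous lambdaMap :=
  Continuous.subtype_mk (differentiableOn_modularLambda.continuousOn.comp_continuous
    UpperHalfPlane.continuous_coe fun τ => τ.im_pos) _

lemma isOpenMap_lambdaMap : IsOpenMap lambdaMap := by
  rw [IsOpenMap.eq_1]
  intro U hU
  rw [isOpen_iff_mem_nhds]
  rintro _ ⟨τ, hτ, rfl⟩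
  rw [nhds_subtype, mem_comap]
  refine ⟨_, nhds_le_map_modularLambda τ.im_pos (image_mem_map
    (UpperHalfPlane.isOpenEmbedding_coe.image_mem_nhds.mpr (hU.mem_nhds hτ))), ?_⟩
  rintro l ⟨_, ⟨ξ, hξ, rfl⟩, h⟩
  exact ⟨ξ, hξ, Subtype.ext h⟩

lemma surjective_lambdaMap : Function.Surjective lambdaMap := fun l =>
  (exists_modularLambda_eq l.2).imp fun _ h => Subtype.ext h

lemma isQuotientCoveringMap_lambdaMap : IsQuotientCoveringMap lambdaMap sanovSubgroup := by
  apply (isOpenMap_lambdaMap.isQuotientMap continuous_lambdaMap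
    surjective_lambdaMap).isQuotientCoveringMap_of_properlyDiscontinuousSMul
  intro τ τ'
  rw [Subtype.ext_iff, coe_lambdaMap, coe_lambdaMap, eq_comm, modularLambda_eq_iff]
  simp [MulAction.mem_orbit_iff, Subtype.exists, Subgroup.smul_def]

end

noncomputable section

open Filter Topology UpperHalfPlane

open scoped MatrixGroups

/-! ### The Sanov subgroup is free -/

/-- The matrices `T²` and `U²` that freely generate the Sanov subgroup. -/
def sanovGenerator (i : Fin 2) : sanovSubgroup :=
  if i = 0 then ⟨⟨!![1, 2; 0, 1], by simp [Matrix.det_fin_two_of]⟩,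
    show _ ∧ _ ∧ _ ∧ _ by simp⟩
  else ⟨⟨!![1, 0; 2, 1], by simp [Matrix.det_fin_two_of]⟩, show _ ∧ _ ∧ _ ∧ _ by simp⟩

lemma SL_mul_apply (g h : SL(2, ℤ)) (i j : Fin 2) :
    (g * h) i j = g i 0 * h 0 j + g i 1 * h 1 j := by
  rw [Matrix.SpecialLinearGroup.coe_mul, Matrix.mul_apply, Fin.sum_univ_two]

lemma sanovGenerator_zero_entries : (sanovGenerator 0).1 0 0 = 1 ∧ (sanovGenerator 0).1 0 1 = 2 ∧
    (sanovGenerator 0).1 1 0 = 0 ∧ (sanovGenerator 0).1 1 1 = 1 := ⟨rfl, rfl, rfl, rfl⟩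

lemma sanovGenerator_one_entries : (sanovGenerator 1).1 0 0 = 1 ∧ (sanovGenerator 1).1 0 1 = 0 ∧
    (sanovGenerator 1).1 1 0 = 2 ∧ (sanovGenerator 1).1 1 1 = 1 := ⟨rfl, rfl, rfl, rfl⟩

lemma sanovGenerator_zero_smul (τ : ℍ) : ((sanovGenerator 0 • τ : ℍ) : ℂ) = τ + 2 := by
  have := SL_smul_mul_denom (sanovGenerator 0).1 τ
  obtain ⟨h1, h2, h3, h4⟩ := sanovGenerator_zero_entries
  rw [h1, h2, h3, h4] at this
  simpa [Subgroup.smul_def] using this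

lemma sanovGenerator_one_smul (τ : ℍ) :
    ((sanovGenerator 1 • τ : ℍ) : ℂ)⁻¹ = (τ : ℂ)⁻¹ + 2 := by
  have := SL_smul_mul_denom (sanovGenerator 1).1 τ
  have h : ((sanovGenerator 1 • τ : ℍ) : ℂ) * (2 * τ + 1) = τ := by
    obtain ⟨h1, h2, h3, h4⟩ := sanovGenerator_one_entries
    rw [h1, h2, h3, h4] at this
    simpa [Subgroup.smul_def] using this
  have h1 := τ.ne_zero
  have h2 := (sanovGenerator 1 • τ).ne_zero
  field_simp
  linear_combination -h

/-- The product is `x²/(x² + y²)`. It separates the regions of the ping-pong argument. -/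
lemma UpperHalfPlane.abs_inv_re_mul_abs_re_lt (τ : ℍ) :
    |((τ : ℂ)⁻¹).re| * |τ.re| < 1 := by
  have hy := τ.im_pos
  have hp : 0 < τ.re * τ.re + τ.im * τ.im := by nlinarith [mul_pos hy hy]
  rw [Complex.inv_re, Complex.normSq_apply, ← abs_mul, coe_re, coe_im, div_mul_eq_mul_div, abs_div,
    abs_of_pos hp, div_lt_one hp, abs_of_nonneg (mul_self_nonneg _)]
  nlinarith [mul_pos hy hy]

/-- Ping-pong: the generators shift `Re τ` and `Re(1/τ)` respectively by `2`, which is the width of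
the gap between the regions `c ≥ 1` and `c < -1`. Regions of different generators are disjoint
because the product of the two coordinates is less than `1` in absolute value. -/
lemma injective_lift_sanovGenerator : Function.Injective (FreeGroup.lift sanovGenerator) := by
  let c (i : Fin 2) (τ : ℍ) : ℝ := if i = 0 then τ.re else ((τ : ℂ)⁻¹).re
  have hc : ∀ i τ, c i (sanovGenerator i • τ) = c i τ + 2 := by
    intro i τ
    fin_cases i
    · have := congrArg Complex.re (sanovGenerator_zero_smul τ)
      simpa [c] using this
    · have := congrArg Complex.re (sanovGenerator_one_smul τ)
      simpa [c] using this
  have hc' : ∀ i τ, c i ((sanovGenerator i)⁻¹ • τ) = c i τ - 2 := by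
    intro i τ
    have := hc i ((sanovGenerator i)⁻¹ • τ)
    rw [smul_inv_smul] at this
    linarith
  have hlt : ∀ i j τ, i ≠ j → |c i τ| * |c j τ| < 1 := by
    intro i j τ hij
    have := τ.abs_inv_re_mul_abs_re_lt
    fin_cases i <;> fin_cases j
    · exact absurd rfl hij
    · simpa [c, mul_comm] using this
    · simpa [c] using this
    · exact absurd rfl hij
  have hmul : ∀ x y : ℝ, 1 ≤ |x| → 1 ≤ |y| → 1 ≤ |x| * |y| := fun x y hx hy =>
    one_le_mul_of_one_le_of_one_le hx hy
  refine FreeGroup.injective_lift_of_ping_pong sanovGenerator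
    (fun i => {τ : ℍ | 1 ≤ c i τ}) (fun i => {τ : ℍ | c i τ < -1}) ?_ ?_ ?_ ?_ ?_ ?_
  · intro i
    fin_cases i
    · exact ⟨⟨⟨1, 1⟩, by simp⟩, by simp [c]⟩
    · refine ⟨⟨(⟨1, -1⟩ : ℂ)⁻¹, ?_⟩, ?_⟩
      · simp [Complex.inv_im, Complex.normSq_apply]
      · simp [c]
  · intro i j hij
    rw [Function.onFun, Set.disjoint_left]
    intro τ (h1 : 1 ≤ c i τ) (h2 : 1 ≤ c j τ)
    exact absurd (hlt i j τ hij) (not_lt.mpr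
      (hmul _ _ (h1.trans (le_abs_self _)) (h2.trans (le_abs_self _))))
  · intro i j hij
    rw [Function.onFun, Set.disjoint_left]
    intro τ (h1 : c i τ < -1) (h2 : c j τ < -1)
    exact absurd (hlt i j τ hij) (not_lt.mpr
      (hmul _ _ (le_abs.mpr (Or.inr (by linarith))) (le_abs.mpr (Or.inr (by linarith)))))
  · intro i j
    rw [Set.disjoint_left]
    intro τ (h1 : 1 ≤ c i τ) (h2 : c j τ < -1)
    by_cases hij : i = j
    · subst hij; linarith
    · exact absurd (hlt i j τ hij) (not_lt.mpr
        (hmul _ _ (h1.trans (le_abs_self _)) (le_abs.mpr (Or.inr (by linarith)))))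
  · rintro i _ ⟨τ, hτ, rfl⟩
    have hτ : ¬ c i τ < -1 := hτ
    change 1 ≤ c i (sanovGenerator i • τ)
    rw [hc]
    linarith
  · rintro i _ ⟨τ, hτ, rfl⟩
    have hτ : ¬ 1 ≤ c i τ := hτ
    change c i ((sanovGenerator i)⁻¹ • τ) < -1
    rw [hc']
    linarith

lemma sanovGenerator_zero_zpow (k : ℤ) :
    (sanovGenerator 0 ^ k).1 0 0 = 1 ∧ (sanovGenerator 0 ^ k).1 0 1 = 2 * k ∧
      (sanovGenerator 0 ^ k).1 1 0 = 0 ∧ (sanovGenerator 0 ^ k).1 1 1 = 1 := by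
  obtain ⟨e1, e2, e3, e4⟩ := sanovGenerator_zero_entries
  have key : ∀ (g : sanovSubgroup) (i : Fin 2), (g * sanovGenerator 0).1 i 0 = g.1 i 0 ∧
      (g * sanovGenerator 0).1 i 1 = 2 * g.1 i 0 + g.1 i 1 := by
    intro g i
    rw [Subgroup.coe_mul, SL_mul_apply, SL_mul_apply, e1, e2, e3, e4]
    constructor <;> ring
  induction k using Int.induction_on with
  | zero => exact ⟨rfl, rfl, rfl, rfl⟩
  | succ k ih =>
    have h0 := key (sanovGenerator 0 ^ (k : ℤ)) 0
    have h1 := key (sanovGenerator 0 ^ (k : ℤ)) 1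
    rw [← zpow_add_one] at h0 h1
    omega
  | pred k ih =>
    have h0 := key (sanovGenerator 0 ^ (-(k : ℤ) - 1)) 0
    have h1 := key (sanovGenerator 0 ^ (-(k : ℤ) - 1)) 1
    rw [← zpow_add_one, sub_add_cancel] at h0 h1
    omega

/-- Euclid's algorithm on the first column `(a, c)`: `a` is odd and `c` even, so `|a| ≠ |c|`, and
while `c ≠ 0` some generator or inverse lowers `|a| + |c|`. With `c = 0` only powers of `T²` remain.
-/
lemma closure_sanovGenerator : Subgroup.closure (Set.range sanovGenerator) = ⊤ := by
  rw [eq_top_iff]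
  rintro g -
  set H := Subgroup.closure (Set.range sanovGenerator) with hH
  have hmem : ∀ i, sanovGenerator i ∈ H := fun i => Subgroup.subset_closure ⟨i, rfl⟩
  have e0 : ∀ h : sanovSubgroup, (sanovGenerator 0 * h).1 0 0 = h.1 0 0 + 2 * h.1 1 0 ∧
      (sanovGenerator 0 * h).1 1 0 = h.1 1 0 := by
    intro h
    obtain ⟨e1, e2, e3, e4⟩ := sanovGenerator_zero_entries
    rw [Subgroup.coe_mul, SL_mul_apply, SL_mul_apply, e1, e2, e3, e4]
    constructor <;> ring
  have e1 : ∀ h : sanovSubgroup, (sanovGenerator 1 * h).1 0 0 = h.1 0 0 ∧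
      (sanovGenerator 1 * h).1 1 0 = 2 * h.1 0 0 + h.1 1 0 := by
    intro h
    obtain ⟨e1, e2, e3, e4⟩ := sanovGenerator_one_entries
    rw [Subgroup.coe_mul, SL_mul_apply, SL_mul_apply, e1, e2, e3, e4]
    constructor <;> ring
  induction hn : (g.1 0 0).natAbs + (g.1 1 0).natAbs using Nat.strong_induction_on
    generalizing g with
  | _ n ih =>
    obtain ⟨ha, hb, hc, hd⟩ := g.2
    by_cases hc0 : g.1 1 0 = 0
    · have hdet := g.1.det_coe
      rw [Matrix.det_fin_two, hc0, mul_zero, sub_zero] at hdet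
      have ha1 : g.1 0 0 = 1 := by
        rcases Int.isUnit_iff.mp (IsUnit.of_mul_eq_one _ hdet) with h | h <;> omega
      have hd1 : g.1 1 1 = 1 := by rw [ha1, one_mul] at hdet; exact hdet
      obtain ⟨k, hk⟩ := hb
      have : g = sanovGenerator 0 ^ k := by
        obtain ⟨h1, h2, h3, h4⟩ := sanovGenerator_zero_zpow k
        apply Subtype.ext
        ext i j
        fin_cases i <;> fin_cases j
        · exact ha1.trans h1.symm
        · exact hk.trans h2.symm
        · exact hc0.trans h3.symm
        · exact hd1.trans h4.symm
      rw [this]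
      exact zpow_mem (hmem 0) k
    · have step : ∀ i, ((sanovGenerator i * g).1 0 0).natAbs +
          ((sanovGenerator i * g).1 1 0).natAbs < n → g ∈ H := fun i hlt =>
        (Subgroup.mul_mem_cancel_left H (hmem i)).mp (ih _ hlt rfl)
      have step' : ∀ i, (((sanovGenerator i)⁻¹ * g).1 0 0).natAbs +
          (((sanovGenerator i)⁻¹ * g).1 1 0).natAbs < n → g ∈ H := fun i hlt =>
        (Subgroup.mul_mem_cancel_left H (inv_mem (hmem i))).mp (ih _ hlt rfl)
      have f0 := e0 g
      have f0' := e0 ((sanovGenerator 0)⁻¹ * g)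
      have f1 := e1 g
      have f1' := e1 ((sanovGenerator 1)⁻¹ * g)
      rw [mul_inv_cancel_left] at f0' f1'
      by_cases hs : 0 < g.1 0 0 ↔ 0 < g.1 1 0
      · by_cases hlt : (g.1 1 0).natAbs < (g.1 0 0).natAbs
        · exact step' 0 (by omega)
        · exact step' 1 (by omega)
      · by_cases hlt : (g.1 1 0).natAbs < (g.1 0 0).natAbs
        · exact step 0 (by omega)
        · exact step 1 (by omega)

/-- The Sanov subgroup is free of rank two. -/
def freeGroupEquivSanov : FreeGroup (Fin 2) ≃* sanovSubgroup :=
  MulEquiv.ofBijective (FreeGroup.lift sanovGenerator) ⟨injective_lift_sanovGenerator, by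
    rw [← MonoidHom.range_eq_top, FreeGroup.range_lift_eq_closure, closure_sanovGenerator]⟩

/-- Residual finiteness of `SL₂(ℤ)`, from which the Hopf property is derived. -/
lemma exists_map_zmod_ne_one {g : SL(2, ℤ)} (hg : g ≠ 1) :
    ∃ N : ℕ, ∃ _ : NeZero N, Matrix.SpecialLinearGroup.map (Int.castRingHom (ZMod N)) g ≠ 1 := by
  obtain ⟨i, j, hij⟩ : ∃ i j, g i j ≠ (1 : SL(2, ℤ)) i j := by
    by_contra! h
    exact hg (by ext i j; exact h i j)
  -- The modulus exceeds the nonzero difference of entries and so cannot divide it.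
  refine ⟨(g i j - (1 : SL(2, ℤ)) i j).natAbs + 1, ⟨by omega⟩, fun h => ?_⟩
  have h1 : ((g i j : ℤ) : ZMod ((g i j - (1 : SL(2, ℤ)) i j).natAbs + 1)) =
      (((1 : SL(2, ℤ)) i j : ℤ) : ZMod _) :=
    congrArg (fun x => x.1 i j) (h.trans (map_one
      (Matrix.SpecialLinearGroup.map (n := Fin 2) (Int.castRingHom _))).symm)
  rw [← sub_eq_zero, ← Int.cast_sub, ZMod.intCast_zmod_eq_zero_iff_dvd] at h1
  have := Int.eq_zero_of_abs_lt_dvd h1 (by rw [Int.abs_eq_natAbs]; omega)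
  exact hij (sub_eq_zero.mp this)

/-- The Sanov subgroup is Hopfian: two elements that generate it generate it freely. -/
lemma injective_of_surjective_sanov {φ : FreeGroup (Fin 2) →* sanovSubgroup}
    (hφ : Function.Surjective φ) : Function.Injective φ := by
  rw [injective_iff_map_eq_one]
  intro w hw
  by_contra hne
  have h1 : (freeGroupEquivSanov w).1 ≠ 1 := by
    intro h
    apply hne
    rw [← map_eq_one_iff _ freeGroupEquivSanov.injective]
    exact Subtype.ext h
  obtain ⟨N, _, hN⟩ := exists_map_zmod_ne_one h1
  let Q := Matrix.SpecialLinearGroup (Fin 2) (ZMod N)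
  let θ : FreeGroup (Fin 2) →* FreeGroup (Fin 2) := freeGroupEquivSanov.symm.toMonoidHom.comp φ
  have hθ : Function.Surjective θ := freeGroupEquivSanov.symm.surjective.comp hφ
  have : Finite (FreeGroup (Fin 2) →* Q) := Finite.of_equiv _ FreeGroup.lift
  -- There are finitely many homomorphisms from `F₂` to the finite group `Q`, and precomposition
  -- with the surjection `θ` is injective on them, hence bijective. So `π` factors through `θ`,
  -- which kills `w`, although `π w ≠ 1`.
  let pull : (FreeGroup (Fin 2) →* Q) → (FreeGroup (Fin 2) →* Q) := fun f => f.comp θ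
  have hpull : Function.Injective pull := fun f f' h => by
    ext1 x
    obtain ⟨y, hy⟩ := hθ (FreeGroup.of x)
    rw [← hy]
    exact DFunLike.congr_fun h y
  let π : FreeGroup (Fin 2) →* Q := (Matrix.SpecialLinearGroup.map (Int.castRingHom (ZMod N))).comp
    (sanovSubgroup.subtype.comp freeGroupEquivSanov.toMonoidHom)
  obtain ⟨f, hf⟩ := Finite.surjective_of_injective hpull π
  apply hN
  have : f (θ w) = π w := DFunLike.congr_fun hf w
  have hθw : θ w = 1 := by
    change freeGroupEquivSanov.symm (φ w) = 1
    rw [hw, map_one]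
  rw [hθw, map_one] at this
  exact this.symm

/-! ### The iterated commutators -/

section Commutators

variable {G : Type*} [Group G] {A X : Set G}

lemma monotone_commutatorLayer : Monotone (commutatorLayer A X) :=
  monotone_nat_of_le_succ fun _ => Subgroup.closure_mono Set.subset_union_left

lemma mem_commutatorHull {g : G} : g ∈ commutatorHull A X ↔ ∃ n, g ∈ commutatorLayer A X n := by
  rw [commutatorHull, Subgroup.closure_iUnion]
  simp only [Subgroup.closure_eq]
  exact Subgroup.mem_iSup_of_directed monotone_commutatorLayer.directed_le

lemma subset_commutatorHull : X ⊆ commutatorHull A X := fun _ hx =>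
  mem_commutatorHull.mpr ⟨0, Subgroup.subset_closure hx⟩

/-- `ada⁻¹ = (ada⁻¹d⁻¹)d`, and the commutator lies in the next layer. -/
lemma conj_mem_commutatorHull {a d : G} (ha : a ∈ A) (hd : d ∈ commutatorHull A X) :
    a * d * a⁻¹ ∈ commutatorHull A X := by
  obtain ⟨n, hn⟩ := mem_commutatorHull.mp hd
  have : a * d * a⁻¹ * d⁻¹ ∈ commutatorHull A X :=
    mem_commutatorHull.mpr ⟨n + 1, Subgroup.subset_closure (Or.inr ⟨a, ha, d, hn, rfl⟩)⟩
  exact (Subgroup.mul_mem_cancel_right _ (inv_mem hd)).mp this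

lemma commutatorHull_le_of_normal {N : Subgroup G} [N.Normal] (hX : X ⊆ N) :
    commutatorHull A X ≤ N := by
  intro g hg
  obtain ⟨n, hn⟩ := mem_commutatorHull.mp hg
  suffices ∀ n, commutatorLayer A X n ≤ N from this n hn
  intro n
  induction n with
  | zero => exact (Subgroup.closure_le _).mpr hX
  | succ n ih =>
    refine (Subgroup.closure_le _).mpr (Set.union_subset ((Subgroup.closure_le _).mp ih) ?_)
    rintro _ ⟨a, -, d, hd, rfl⟩
    exact mul_mem (Subgroup.Normal.conj_mem inferInstance d (ih hd) a) (inv_mem (ih hd))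

/-- The normalizer contains `A`, which is closed under inverses, and `X`, which lies in the hull
itself. -/
lemma normal_commutatorHull (hA : ∀ a ∈ A, a⁻¹ ∈ A) (hgen : Subgroup.closure (A ∪ X) = ⊤) :
    (commutatorHull A X).Normal := by
  rw [← Subgroup.normalizer_eq_top_iff, eq_top_iff, ← hgen, Subgroup.closure_le]
  rintro x (hx | hx)
  · rw [SetLike.mem_coe, Subgroup.mem_normalizer_iff]
    refine fun h => ⟨conj_mem_commutatorHull hx, fun hh => ?_⟩
    have := conj_mem_commutatorHull (hA x hx) hh
    simpa [mul_assoc] using this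
  · exact Subgroup.le_normalizer (subset_commutatorHull hx)

/-- If `G` is generated by `a₀`, `a₁` and a subset `X` of the kernel of a surjection onto (the
opposite of) the Sanov subgroup, then this kernel is the subgroup of iterated commutators. -/
lemma ker_eq_commutatorHull {a₀ a₁ : G} (hgen : Subgroup.closure ({a₀, a₁} ∪ X) = ⊤)
    {Θ : G →* sanovSubgroupᵐᵒᵖ} (hΘ : Function.Surjective Θ) (hX : ∀ d ∈ X, Θ d = 1) :
    Θ.ker = commutatorHull {a₀, a₀⁻¹, a₁, a₁⁻¹} X := by
  set A : Set G := {a₀, a₀⁻¹, a₁, a₁⁻¹} with hA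
  have hle : commutatorHull A X ≤ Θ.ker := commutatorHull_le_of_normal hX
  have hnormal : (commutatorHull A X).Normal := by
    apply normal_commutatorHull
    · rintro a (rfl | rfl | rfl | rfl) <;> simp [hA]
    · rw [eq_top_iff, ← hgen]
      refine Subgroup.closure_mono (Set.union_subset_union_left _ ?_)
      rintro a (rfl | rfl) <;> simp [hA]
  let f : FreeGroup (Fin 2) →* G := FreeGroup.lift ![a₀, a₁]
  have htop : f.range ⊔ commutatorHull A X = ⊤ := by
    rw [eq_top_iff, ← hgen, Subgroup.closure_le]
    rintro x ((rfl | rfl) | hx)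
    · exact Subgroup.mem_sup_left ⟨FreeGroup.of 0, by simp [f]⟩
    · exact Subgroup.mem_sup_left ⟨FreeGroup.of 1, by simp [f]⟩
    · exact Subgroup.mem_sup_right (subset_commutatorHull hx)
  have hdecomp : ∀ g, ∃ w, ∃ k ∈ commutatorHull A X, f w * k = g := by
    intro g
    obtain ⟨_, ⟨w, rfl⟩, k, hk, h⟩ := Subgroup.mem_sup_of_normal_right.mp
      (htop.symm ▸ Subgroup.mem_top g)
    exact ⟨w, k, hk, h⟩
  -- Inversion identifies the opposite group with the Sanov subgroup. Since `Θ` kills the hull and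
  -- `G` is the image of `F₂` times the hull, `φ` is onto, hence injective by the Hopf property.
  let φ : FreeGroup (Fin 2) →* sanovSubgroup :=
    (MulEquiv.inv' sanovSubgroup).symm.toMonoidHom.comp (Θ.comp f)
  have hφ : Function.Surjective φ := by
    refine (MulEquiv.inv' sanovSubgroup).symm.surjective.comp fun y => ?_
    obtain ⟨g, rfl⟩ := hΘ y
    obtain ⟨w, k, hk, rfl⟩ := hdecomp g
    exact ⟨w, by rw [map_mul, MonoidHom.mem_ker.mp (hle hk), mul_one]; rfl⟩
  refine le_antisymm (fun g hg => ?_) hle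
  obtain ⟨w, k, hk, rfl⟩ := hdecomp g
  rw [MonoidHom.mem_ker, map_mul, MonoidHom.mem_ker.mp (hle hk), mul_one] at hg
  have : w = 1 := by
    apply injective_of_surjective_sanov hφ
    rw [map_one]
    change (MulEquiv.inv' sanovSubgroup).symm (Θ (f w)) = 1
    rw [hg, map_one]
  rw [this, map_one, one_mul]
  exact hk

end Commutators

end

noncomputable section

open Filter Topology

/-! ### Moving paths on a surface off a countable set -/

section AvoidCountable

variable {X : Type*} [TopologicalSpace X]

/-- A homotopy class of paths is represented by a path that avoids `F`. -/
def Path.Homotopic.Quotient.Avoids (F : Set X) {x y : X} (a : Path.Homotopic.Quotient x y) : Prop :=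
  ∃ δ : Path x y, (∀ t, δ t ∉ F) ∧ Path.Homotopic.Quotient.mk δ = a

lemma Path.Homotopic.Quotient.Avoids.trans {F : Set X} {x y z : X}
    {a : Path.Homotopic.Quotient x y} {b : Path.Homotopic.Quotient y z} (ha : a.Avoids F)
    (hb : b.Avoids F) : (a.trans b).Avoids F := by
  obtain ⟨δ, hδ, rfl⟩ := ha
  obtain ⟨ε, hε, rfl⟩ := hb
  refine ⟨δ.trans ε, fun t => ?_, Path.Homotopic.Quotient.mk_trans _ _⟩
  have : (δ.trans ε) t ∈ Set.range δ ∪ Set.range ε := by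
    rw [← Path.trans_range]
    exact ⟨t, rfl⟩
  rcases this with ⟨s, hs⟩ | ⟨s, hs⟩ <;> rw [← hs]
  exacts [hδ s, hε s]

lemma one_lt_rank_real_complex : 1 < Module.rank ℝ ℂ := by
  rw [Complex.rank_real_complex]; norm_num

/-- In the plane the complement of a countable set is path connected, and all paths with the same
ends are homotopic. -/
lemma Path.avoids_of_isOpenEmbedding {φ : ℂ → X} (hφ : IsOpenEmbedding φ) {F : Set X}
    (hF : F.Countable) {x y : X} (γ : Path x y) (hγ : Set.range γ ⊆ Set.range φ) (hx : x ∉ F)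
    (hy : y ∉ F) : (Path.Homotopic.Quotient.mk γ).Avoids F := by
  obtain ⟨u, rfl⟩ : x ∈ Set.range φ := hγ ⟨0, γ.source⟩
  obtain ⟨v, rfl⟩ : y ∈ Set.range φ := hγ ⟨1, γ.target⟩
  let e := hφ.isEmbedding.toHomeomorph
  let g : C(I, ℂ) := ⟨fun t => e.symm ⟨γ t, hγ ⟨t, rfl⟩⟩, by fun_prop⟩
  have hg : ∀ t, φ (g t) = γ t := fun t =>
    congrArg Subtype.val (e.apply_symm_apply ⟨γ t, hγ ⟨t, rfl⟩⟩)
  let γ' : Path u v := ⟨g, hφ.injective ((hg 0).trans γ.source),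
    hφ.injective ((hg 1).trans γ.target)⟩
  obtain ⟨δ, hδ⟩ := ((hF.preimage_of_injOn
    hφ.injective.injOn).isPathConnected_compl_of_one_lt_rank one_lt_rank_real_complex).joinedIn
      u hx v hy
  refine ⟨δ.map hφ.continuous, hδ, ?_⟩
  have h1 : γ = γ'.map hφ.continuous := by
    ext t
    exact (hg t).symm
  rw [h1]
  exact Path.Homotopic.Quotient.eq.mpr
    ((SimplyConnectedSpace.paths_homotopic δ γ').map ⟨φ, hφ.continuous⟩)

lemma exists_path_notMem_of_isOpenEmbedding {φ : ℂ → X} (hφ : IsOpenEmbedding φ) {F : Set X}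
    (hF : F.Countable) {p : X} (hp : p ∈ Set.range φ) {O : Set X} (hO : IsOpen O) (hpO : p ∈ O) :
    ∃ z ∉ F, ∃ κ : Path p z, Set.range κ ⊆ O := by
  obtain ⟨u, rfl⟩ := hp
  obtain ⟨r, hr, hball⟩ := Metric.isOpen_iff.mp (hO.preimage hφ.continuous) u hpO
  obtain ⟨v, hvF, hv⟩ := ((hF.preimage_of_injOn hφ.injective.injOn).dense_compl ℝ).exists_dist_lt u hr
  obtain ⟨κ, hκ⟩ := ((convex_ball u r).isPathConnected ⟨u, Metric.mem_ball_self hr⟩).joinedIn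
    u (Metric.mem_ball_self hr) v (by rwa [Metric.mem_ball, dist_comm])
  refine ⟨φ v, hvF, κ.map hφ.continuous, ?_⟩
  rintro _ ⟨t, rfl⟩
  exact hball (hκ t)

variable (hX : ∀ x : X, ∃ φ : ℂ → X, IsOpenEmbedding φ ∧ x ∈ Set.range φ)
include hX

/-- Subdivide the path so that each piece lies in one chart. A division point may lie in `F`, so
insert there a short detour to a point off `F` and back, then replace each piece with its detours
inside its chart. -/
lemma Path.avoids_of_countable {F : Set X} (hF : F.Countable) {x y : X} (γ : Path x y)
    (hx : x ∉ F) (hy : y ∉ F) : (Path.Homotopic.Quotient.mk γ).Avoids F := by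
  choose φ hφ hmem using hX
  obtain ⟨t, ht0, htm, ⟨n, hn⟩, hsub⟩ := exists_monotone_Icc_subset_open_cover_unitInterval
    (c := fun x => γ ⁻¹' Set.range (φ x)) (fun x => (hφ x).isOpen_range.preimage γ.continuous)
    (fun s _ => Set.mem_iUnion.mpr ⟨γ s, hmem _⟩)
  choose i hi using hsub
  have hseg : ∀ n, Set.range (γ.subpath (t n) (t (n + 1))) ⊆ Set.range (φ (i n)) := by
    intro n
    rw [Path.range_subpath_of_le _ _ _ (htm n.le_succ)]
    exact Set.image_subset_iff.mpr (hi n)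
  -- Induction statement: the path up to `s`, followed by a detour `κ` inside `W`, can avoid `F`.
  -- Keeping `κ` in the next chart lets the next step undo it there.
  let P (s : I) (W : Set X) : Prop := ∃ z ∉ F, ∃ κ : Path (γ s) z, Set.range κ ⊆ W ∧
    (Path.Homotopic.Quotient.mk ((γ.subpath 0 s).trans κ)).Avoids F
  have hP : ∀ n, P (t n) (Set.range (φ (i n))) := by
    intro n
    induction n with
    | zero =>
      have h0 : γ (t 0) ∈ Set.range (φ (i 0)) := hi 0 ⟨le_rfl, htm (Nat.le_succ 0)⟩
      rw [ht0] at h0 ⊢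
      have hx' : γ 0 ∉ F := by rwa [γ.source]
      refine ⟨γ 0, hx', Path.refl _, ?_, (γ.subpath 0 0).trans (Path.refl _), fun s => ?_, rfl⟩
      · rw [Path.refl_range, Set.singleton_subset_iff]
        exact h0
      · rw [Path.subpath_self]
        simpa using hx'
    | succ n ih =>
      obtain ⟨z, hz, κ, hκ, ha⟩ := ih
      have h1 : γ (t (n + 1)) ∈ Set.range (φ (i n)) := hi n ⟨htm n.le_succ, le_rfl⟩
      have h2 : γ (t (n + 1)) ∈ Set.range (φ (i (n + 1))) := hi (n + 1) ⟨le_rfl, htm (n + 1).le_succ⟩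
      obtain ⟨z', hz', κ', hκ'⟩ := exists_path_notMem_of_isOpenEmbedding (hφ (i n)) hF h1
        ((hφ (i n)).isOpen_range.inter (hφ (i (n + 1))).isOpen_range) ⟨h1, h2⟩
      refine ⟨z', hz', κ', hκ'.trans Set.inter_subset_right, ?_⟩
      have hb := Path.avoids_of_isOpenEmbedding (hφ (i n)) hF
        (κ.symm.trans ((γ.subpath (t n) (t (n + 1))).trans κ')) (by
          rw [Path.trans_range, Path.trans_range, Path.symm_range]
          exact Set.union_subset hκ (Set.union_subset (hseg n) (hκ'.trans Set.inter_subset_left)))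
        hz hz'
      have hab := ha.trans hb
      have hsp : Path.Homotopic.Quotient.mk ((γ.subpath 0 (t n)).trans
          (γ.subpath (t n) (t (n + 1)))) = Path.Homotopic.Quotient.mk (γ.subpath 0 (t (n + 1))) :=
        Path.Homotopic.Quotient.eq.mpr ⟨Path.Homotopy.subpathTransSubpath γ 0 (t n) (t (n + 1))⟩
      rw [Path.Homotopic.Quotient.mk_trans] at hsp
      simp only [Path.Homotopic.Quotient.mk_trans, Path.Homotopic.Quotient.mk_symm] at hab ⊢
      rw [Path.Homotopic.Quotient.trans_assoc, ← Path.Homotopic.Quotient.trans_assoc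
        (Path.Homotopic.Quotient.mk κ), Path.Homotopic.Quotient.trans_symm,
        Path.Homotopic.Quotient.refl_trans, ← Path.Homotopic.Quotient.trans_assoc, hsp] at hab
      exact hab
  have hfin := hP n
  rw [hn n le_rfl] at hfin
  obtain ⟨z, hz, κ, hκ, ha⟩ := hfin
  have hy' : γ 1 ∉ F := by rwa [γ.target]
  obtain ⟨δ, hδ, h⟩ := ha.trans
    (Path.avoids_of_isOpenEmbedding (hφ (i n)) hF κ.symm (by rwa [Path.symm_range]) hz hy')
  rw [Path.Homotopic.Quotient.mk_trans, Path.Homotopic.Quotient.mk_symm,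
    Path.Homotopic.Quotient.trans_assoc, Path.Homotopic.Quotient.trans_symm,
    Path.Homotopic.Quotient.trans_refl, Path.subpath_zero_one] at h
  refine ⟨δ.cast γ.source.symm γ.target.symm, hδ, ?_⟩
  rw [Path.Homotopic.Quotient.mk_cast, h, ← Path.Homotopic.Quotient.mk_cast]
  rfl

lemma FundamentalGroup.map_surjective_of_countable_compl {U : Set X} (hU : Uᶜ.Countable)
    (ι : C(U, X)) (hι : ∀ u, ι u = u) (u : U) :
    Function.Surjective (FundamentalGroup.map ι u) := by
  intro a
  obtain ⟨γ, rfl⟩ := Path.Homotopic.Quotient.mk_surjective a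
  have hu : ι u ∉ Uᶜ := by rw [hι]; exact not_not.mpr u.2
  obtain ⟨δ, hδ, h⟩ := Path.avoids_of_countable hX hU γ hu hu
  have hmem : ∀ t, δ t ∈ U := fun t => not_not.mp (hδ t)
  let δ' : Path u u := ⟨⟨fun t => ⟨δ t, hmem t⟩, by fun_prop⟩,
    Subtype.ext (by rw [← hι u]; exact δ.source), Subtype.ext (by rw [← hι u]; exact δ.target)⟩
  refine ⟨FundamentalGroup.fromPath (Path.Homotopic.Quotient.mk δ'), ?_⟩
  rw [← h]
  change Path.Homotopic.Quotient.mk (δ'.map ι.continuous) = _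
  congr 1
  ext t
  exact hι _

end AvoidCountable

/-- A coordinate disc around `x` is homeomorphic to the whole plane. -/
lemma exists_isOpenEmbedding_of_chartedSpace {X : Type*} [TopologicalSpace X] [ChartedSpace ℂ X]
    (x : X) : ∃ φ : ℂ → X, IsOpenEmbedding φ ∧ x ∈ Set.range φ := by
  let c := chartAt ℂ x
  obtain ⟨r, hr, hball⟩ := Metric.isOpen_iff.mp c.open_target (c x) (mem_chart_target ℂ x)
  let e := (OpenPartialHomeomorph.univBall (c x) r).trans c.symm
  have he : e.source = Set.univ := by
    rw [OpenPartialHomeomorph.trans_source, OpenPartialHomeomorph.univBall_source, Set.univ_inter,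
      Set.eq_univ_iff_forall]
    intro z
    apply hball
    rw [← OpenPartialHomeomorph.univBall_target (c x) hr]
    exact (OpenPartialHomeomorph.univBall (c x) r).map_source (by simp)
  refine ⟨e, e.isOpenEmbedding he, 0, ?_⟩
  change c.symm (OpenPartialHomeomorph.univBall (c x) r 0) = x
  rw [OpenPartialHomeomorph.univBall_apply_zero]
  exact c.left_inv (mem_chart_source ℂ x)

/-! ### The monodromy of `λ` on the fundamental group of the punctured base -/

open UpperHalfPlane

open scoped MatrixGroups

lemma countable_fiber_lambdaMap (l : legendreBase) : (lambdaMap ⁻¹' {l}).Countable := by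
  obtain ⟨τ, hτ⟩ := surjective_lambdaMap l
  have hSL : Countable SL(2, ℤ) :=
    Function.Injective.countable (f := fun (g : SL(2, ℤ)) (i j : Fin 2) => g i j)
      fun g h e => by ext i j; exact congrFun (congrFun e i) j
  exact (isQuotientCoveringMap_lambdaMap.fiberEquivGroup ⟨τ, hτ⟩).countable_iff.mpr inferInstance

section Punctured

variable {Ω : Set ℂ} {s : Ω} (ι : C(Ω, legendreBase)) (hι : ∀ x, (ι x : ℂ) = x)
  (e : lambdaMap ⁻¹' {ι s})

/-- The monodromy of the covering `λ` along loops in an open subset of the base. -/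
def lambdaMonodromy : FundamentalGroup Ω s →* sanovSubgroupᵐᵒᵖ :=
  (isQuotientCoveringMap_lambdaMap.fundamentalGroupToMulOpposite e).comp (FundamentalGroup.map ι s)

include hι

/-- Join `e` to `ge` in `ℍ` by a path avoiding the countable preimage of the removed points; its
image is a loop in `Ω` with monodromy `g`. -/
lemma surjective_lambdaMonodromy (hΩ : (legendreBase \ Ω).Countable) :
    Function.Surjective (lambdaMonodromy ι e) := by
  intro g
  set F : Set ℍ := {τ | modularLambda τ ∉ Ω} with hF
  have hFc : F.Countable := by
    have hc : {l : legendreBase | (l : ℂ) ∉ Ω}.Countable := by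
      refine (hΩ.preimage_of_injOn (f := ((↑) : legendreBase → ℂ))
        Subtype.val_injective.injOn).mono fun l (hl : (l : ℂ) ∉ Ω) => ?_
      exact ⟨l.2, hl⟩
    refine (hc.biUnion fun l _ => countable_fiber_lambdaMap l).mono fun τ hτ => ?_
    rw [Set.mem_iUnion₂]
    exact ⟨lambdaMap τ, hτ, rfl⟩
  have he : modularLambda e = s :=
    (congrArg Subtype.val (e.2 : lambdaMap e = ι s)).trans (hι s)
  have hge : modularLambda (g.unop • (e : ℍ) : ℍ) = s := by
    rw [← he]
    exact modularLambda_sanov_smul g.unop.2 _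
  have heF : (e : ℍ) ∉ F := fun h => h (by rw [he]; exact s.2)
  have hgeF : g.unop • (e : ℍ) ∉ F := fun h => h (by rw [hge]; exact s.2)
  obtain ⟨δ, hδ, -⟩ := Path.avoids_of_countable exists_isOpenEmbedding_of_chartedSpace hFc
    (PathConnectedSpace.somePath (e : ℍ) (g.unop • (e : ℍ))) heF hgeF
  have hcont : Continuous fun τ : ℍ => modularLambda τ :=
    continuous_subtype_val.comp continuous_lambdaMap
  let γ : Path s s := ⟨⟨fun t => ⟨modularLambda (δ t), not_not.mp (hδ t)⟩,
    (hcont.comp δ.continuous).subtype_mk _⟩, Subtype.ext (by simpa using he), Subtype.ext (by simpa using hge)⟩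
  refine ⟨FundamentalGroup.fromPath (Path.Homotopic.Quotient.mk γ), ?_⟩
  rw [lambdaMonodromy, MonoidHom.comp_apply,
    IsQuotientCoveringMap.fundamentalGroupToMulOpposite_apply_eq_Iff]
  symm
  have hmem : lambdaMap (g.unop • (e : ℍ)) = ι s := Subtype.ext (by rw [hι]; exact hge)
  refine congrArg Subtype.val (isQuotientCoveringMap_lambdaMap.isCoveringMap.monodromy_eq_of_map_eq
    (ex := e) (ey := ⟨_, hmem⟩) (Path.Homotopic.Quotient.mk δ) ?_)
  rw [← Path.Homotopic.Quotient.mk_map]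
  refine Eq.trans ?_ (Path.Homotopic.Quotient.mk_cast (γ.map ι.continuous) e.2 hmem)
  congr 1
  ext t
  exact (hι (γ t)).symm

/-- With the centre `q` filled in, the circle lies in a disc inside `S` and contracts; the path to
it and back then cancels. -/
lemma map_eq_one_of_isSmallLoopAround {q : ℂ} (hq : q ∈ legendreBase) (hΩ : Ω ⊆ legendreBase)
    {g : FundamentalGroup Ω s} (hg : IsSmallLoopAround q g) :
    FundamentalGroup.map ι s g = 1 := by
  obtain ⟨ε, hε, hball, x, β, c, hc, rfl⟩ := hg
  have hsub : Metric.closedBall q ε ⊆ legendreBase := by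
    intro z hz
    by_cases h : z = q
    · rwa [h]
    · exact hΩ (hball ⟨hz, h⟩)
  let D := Metric.closedBall q ε
  have : ContractibleSpace D :=
    (convex_closedBall q ε).contractibleSpace ⟨q, Metric.mem_closedBall_self hε.le⟩
  have hcD : ∀ t, (c t : ℂ) ∈ D := by
    intro t
    rw [Metric.mem_closedBall, hc, dist_self_add_left, norm_mul, Complex.norm_real,
      Real.norm_of_nonneg hε.le]
    have : 2 * (Real.pi : ℂ) * Complex.I * ((t : ℝ) : ℂ) =
        ((2 * Real.pi * (t : ℝ) : ℝ) : ℂ) * Complex.I := by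
      push_cast; ring
    rw [this, Complex.norm_exp_ofReal_mul_I, mul_one]
  have hxD : (x : ℂ) ∈ D := by
    have := hcD 0
    rwa [c.source] at this
  let d : Path (⟨x, hxD⟩ : D) ⟨x, hxD⟩ := ⟨⟨fun t => ⟨c t, hcD t⟩, by fun_prop⟩,
    Subtype.ext (by simp), Subtype.ext (by simp)⟩
  let k : C(D, legendreBase) := ⟨fun z => ⟨z, hsub z.2⟩, by fun_prop⟩
  have hk : k ⟨x, hxD⟩ = ι x := Subtype.ext (hι x).symm
  have h1 : c.map ι.continuous = (d.map k.continuous).cast hk.symm hk.symm := by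
    ext t
    exact hι _
  have h2 : Path.Homotopic.Quotient.mk (c.map ι.continuous) = Path.Homotopic.Quotient.refl (ι x) := by
    rw [h1, ← Path.Homotopic.Quotient.mk_refl]
    have : (Path.refl (ι x)) = ((Path.refl (⟨x, hxD⟩ : D)).map k.continuous).cast hk.symm hk.symm := by
      ext t
      exact hι _
    rw [this]
    exact Path.Homotopic.Quotient.eq.mpr
      (((SimplyConnectedSpace.paths_homotopic d (Path.refl _)).map k).pathCast _ _)
  change Path.Homotopic.Quotient.mk (((β.trans c).trans β.symm).map ι.continuous) =
    Path.Homotopic.Quotient.refl _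
  rw [Path.map_trans, Path.map_trans, show β.symm.map ι.continuous = (β.map ι.continuous).symm from
    rfl, Path.Homotopic.Quotient.mk_trans,
    Path.Homotopic.Quotient.mk_trans, Path.Homotopic.Quotient.mk_symm, h2,
    Path.Homotopic.Quotient.trans_refl, Path.Homotopic.Quotient.trans_symm]

lemma ker_lambdaMonodromy (hΩ : Ω ⊆ legendreBase) (hΩc : (legendreBase \ Ω).Countable)
    {a₀ a₁ : FundamentalGroup Ω s} {X : Set (FundamentalGroup Ω s)}
    (hgen : Subgroup.closure ({a₀, a₁} ∪ X) = ⊤)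
    (hX : ∀ d ∈ X, ∃ q ∈ legendreBase, IsSmallLoopAround q d) :
    (lambdaMonodromy ι e).ker = commutatorHull {a₀, a₀⁻¹, a₁, a₁⁻¹} X := by
  apply ker_eq_commutatorHull hgen (surjective_lambdaMonodromy ι hι e hΩc)
  intro d hd
  obtain ⟨q, hq, hs⟩ := hX d hd
  rw [lambdaMonodromy, MonoidHom.comp_apply, map_eq_one_of_isSmallLoopAround ι hι hq hΩ hs, map_one]

end Punctured

end

noncomputable section

open Filter Topology UpperHalfPlane

/-! ### Continuation of periods -/

/-- A holomorphic local inverse of `λ`. -/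
lemma exists_localInverse_modularLambda (τ : ℍ) : ∃ h : ℂ → ℂ, h (modularLambda τ) = τ ∧
    (∀ᶠ l in 𝓝 (modularLambda τ),
      DifferentiableAt ℂ h l ∧ 0 < (h l).im ∧ modularLambda (h l) = l) ∧
    ∀ᶠ z in 𝓝 (τ : ℂ), h (modularLambda z) = z := by
  have ha := analyticAt_modularLambda τ.im_pos
  have hd := deriv_modularLambda_ne_zero τ.im_pos
  have hs := ha.hasStrictDerivAt
  have hinv := ha.analyticAt_localInverse hd
  have hl := hs.eventually_left_inverse hd
  have h0 := hl.self_of_nhds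
  refine ⟨_, h0, ?_, hl⟩
  have him := hinv.continuousAt.eventually (h0 ▸ isOpen_im_pos.mem_nhds τ.im_pos)
  filter_upwards [hinv.eventually_analyticAt, him, hs.eventually_right_inverse hd] with l h1 h2 h3
  exact ⟨h1.differentiableAt, h2, h3⟩

/-- The period `m ω₁ + n ω₂` of the Legendre curve with parameter `λ(τ)`. -/
def periodVector (τ : ℂ) (v : ℤ × ℤ) : ℂ := periodScale τ * (v.1 + v.2 * τ)

lemma periodVector_mem {τ : ℍ} {l : ℂ} (h : modularLambda τ = l) (v : ℤ × ℤ) :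
    periodVector τ v ∈ periodLattice l := by
  rw [← h, mem_periodLattice_modularLambda]
  exact ⟨v.1, v.2, rfl⟩

lemma exists_periodVector_eq {τ : ℍ} {l z : ℂ} (h : modularLambda τ = l)
    (hz : z ∈ periodLattice l) : ∃ v, periodVector τ v = z := by
  rw [← h, mem_periodLattice_modularLambda] at hz
  obtain ⟨m, n, hmn⟩ := hz
  exact ⟨(m, n), hmn⟩

lemma periodVector_injective (τ : ℍ) : Function.Injective (periodVector τ) := by
  intro v w h
  have := intCast_add_mul_inj (mul_left_cancel₀ (periodScale_ne_zero τ.im_pos) h)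
  exact Prod.ext this.1 this.2

section Continuation

variable {B : Type*} [TopologicalSpace B] [ChartedSpace ℂ B] {p : B → legendreBase}
  {b c : B} {γ : Path b c} {τ : C(I, ℍ)}

/-- The germ at time `t` is the period with coordinates `v`, evaluated on the local inverse of `λ`
through `τ t` and composed with `p`. -/
lemma exists_isPeriodContinuation (hol : MDifferentiable 𝓘(ℂ) 𝓘(ℂ) (fun x => (p x : ℂ)))
    (hτ : ∀ t, modularLambda (τ t) = p (γ t)) (v : ℤ × ℤ) :
    ∃ f : I → B → ℂ, IsPeriodContinuation p γ f ∧ ∀ t, f t (γ t) = periodVector (τ t) v := by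
  choose h h0 hev hinv using exists_localInverse_modularLambda
  have hpc : Continuous fun x => (p x : ℂ) := hol.continuous
  refine ⟨fun t x => periodVector (h (τ t) (p x)) v, fun t => ⟨?_, ?_⟩, fun t => ?_⟩
  · have := hev (τ t)
    rw [hτ t] at this
    filter_upwards [hpc.continuousAt.eventually this] with x hx
    obtain ⟨h1, h2, h3⟩ := hx
    refine ⟨?_, periodVector_mem (τ := ⟨_, h2⟩) h3 v⟩
    have hd : DifferentiableAt ℂ (fun l => periodVector (h (τ t) l) v) (p x : ℂ) := by
      have := (differentiableAt_periodScale h2).fun_comp' (p x : ℂ) h1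
      simp only [periodVector]
      fun_prop
    exact DifferentiableAt.comp_mdifferentiableAt (f := fun x => (p x : ℂ))
      (g := fun l => periodVector (h (τ t) l) v) hd (hol x)
  · -- the local inverses at nearby parameters agree
    have hev' := (hev (τ t)).eventually_nhds
    have hcont : Tendsto (fun u => modularLambda (τ u)) (𝓝 t) (𝓝 (modularLambda (τ t))) := by
      simp only [hτ]
      exact (hpc.comp γ.continuous).tendsto t
    have hcoe : Tendsto (fun u => (τ u : ℂ)) (𝓝 t) (𝓝 (τ t : ℂ)) :=
      (UpperHalfPlane.continuous_coe.comp τ.continuous).tendsto t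
    filter_upwards [hcont.eventually hev', hcoe.eventually (hinv (τ t))] with u hu hu'
    have hc : Tendsto (h (τ t)) (𝓝 (modularLambda (τ u))) (𝓝 (τ u : ℂ)) := by
      have := hu.self_of_nhds.1.continuousAt.tendsto
      rwa [hu'] at this
    have hagree : ∀ᶠ l in 𝓝 (modularLambda (τ u)), h (τ u) l = h (τ t) l := by
      filter_upwards [hu, hc.eventually (hinv (τ u))] with l hl hl'
      rwa [hl.2.2] at hl'
    rw [hτ u] at hagree
    filter_upwards [hpc.continuousAt.eventually hagree] with x hx
    rw [hx]
  · simp only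
    rw [← hτ t, h0]

/-- Rigidity of continuation: the coordinates in the basis `ω, ωτ` along the lift are continuous and
integral, hence constant. -/
lemma IsPeriodContinuation.exists_periodVector {f : I → B → ℂ} (hf : IsPeriodContinuation p γ f)
    (hτ : ∀ t, modularLambda (τ t) = p (γ t)) :
    ∃ v : ℤ × ℤ, ∀ t, f t (γ t) = periodVector (τ t) v := by
  have hmem : ∀ t, f t (γ t) ∈ periodLattice (p (γ t)) := fun t => (hf t).1.self_of_nhds.2
  choose v hv using fun t => exists_periodVector_eq (hτ t) (hmem t)
  have hcoe : Continuous fun u => (τ u : ℂ) := UpperHalfPlane.continuous_coe.comp τ.continuous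
  have hloc : IsLocallyConstant v := by
    rw [IsLocallyConstant.iff_eventually_eq]
    intro t
    have hft : Tendsto (fun u => f t (γ u)) (𝓝 t) (𝓝 (f t (γ t))) :=
      (hf t).1.self_of_nhds.1.continuousAt.tendsto.comp (γ.continuous.tendsto t)
    have hsc : Tendsto (fun u => periodScale (τ u)) (𝓝 t) (𝓝 (periodScale (τ t))) :=
      (differentiableAt_periodScale (τ t).im_pos).continuousAt.tendsto.comp (hcoe.tendsto t)
    have hq := hft.div hsc (periodScale_ne_zero (τ t).im_pos)
    have hq' : Tendsto (fun u => ((v u).1 : ℂ) + (v u).2 * τ u) (𝓝 t)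
        (𝓝 ((v t).1 + (v t).2 * τ t)) := by
      rw [← hv t, periodVector, mul_div_cancel_left₀ _ (periodScale_ne_zero (τ t).im_pos)] at hq
      refine hq.congr' ?_
      filter_upwards [(hf t).2] with u hu
      rw [Pi.div_apply, ← hu.self_of_nhds, ← hv u, periodVector,
        mul_div_cancel_left₀ _ (periodScale_ne_zero (τ u).im_pos)]
    -- The coefficient of `τ` is recovered as a quotient of imaginary parts.
    have him : Tendsto (fun u => (((v u).1 : ℂ) + (v u).2 * τ u).im / (τ u : ℂ).im) (𝓝 t)
        (𝓝 (((v t).1 + (v t).2 * τ t : ℂ).im / (τ t : ℂ).im)) :=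
      ((Complex.continuous_im.tendsto _).comp hq').div
        ((Complex.continuous_im.comp hcoe).tendsto t) (τ t).im_pos.ne'
    have h2 : ∀ u, ((((v u).1 : ℂ) + (v u).2 * τ u).im / (τ u : ℂ).im) = ((v u).2 : ℝ) := by
      intro u
      have : ((τ u : ℍ) : ℂ).im ≠ 0 := (τ u).im_pos.ne'
      simp only [Complex.add_im, Complex.mul_im, Complex.intCast_re, Complex.intCast_im, zero_mul,
        add_zero, zero_add]
      field_simp
    simp only [h2] at him
    have hn : ∀ᶠ u in 𝓝 t, (v u).2 = (v t).2 := by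
      have := (Int.isClosedEmbedding_coe_real.isInducing.tendsto_nhds_iff (f := fun u => (v u).2)).mpr him
      simpa [nhds_discrete] using this
    have hm : ∀ᶠ u in 𝓝 t, (v u).1 = (v t).1 := by
      have h3 : Tendsto (fun u => ((v u).1 : ℂ)) (𝓝 t) (𝓝 ((v t).1 : ℂ)) := by
        have := hq'.sub ((hcoe.tendsto t).const_mul (((v t).2 : ℤ) : ℂ))
        rw [add_sub_cancel_right] at this
        refine this.congr' ?_
        filter_upwards [hn] with u hu
        rw [hu, add_sub_cancel_right]
      have h4 : Tendsto (fun u => ((v u).1 : ℝ)) (𝓝 t) (𝓝 ((v t).1 : ℝ)) := by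
        have := (Complex.continuous_re.tendsto _).comp h3
        simpa [Function.comp_def] using this
      have := (Int.isClosedEmbedding_coe_real.isInducing.tendsto_nhds_iff (f := fun u => (v u).1)).mpr h4
      simpa [nhds_discrete] using this
    filter_upwards [hm, hn] with u h1 h2
    exact Prod.ext h1 h2
  refine ⟨v 0, fun t => ?_⟩
  rw [← hv t, hloc.apply_eq_of_preconnectedSpace t 0]

end Continuation

/-! ### The monodromy representation -/

/-- The basis of the periods of the Legendre curve with parameter `λ(τ)`. -/
def periodEquiv {l : legendreBase} (τ : lambdaMap ⁻¹' {l}) : (ℤ × ℤ) ≃ₗ[ℤ] periodLattice l :=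
  LinearEquiv.ofBijective
    { toFun := fun v => ⟨periodVector (τ : ℍ) v, periodVector_mem (congrArg Subtype.val τ.2) v⟩
      map_add' := fun v w => Subtype.ext (by
        simp only [periodVector, Prod.fst_add, Prod.snd_add, Int.cast_add, Submodule.coe_add]
        ring)
      map_smul' := fun k v => Subtype.ext (by
        change periodVector (τ : ℍ) (k • v) = k • periodVector (τ : ℍ) v
        simp only [periodVector, Prod.smul_fst, Prod.smul_snd, smul_eq_mul, Int.cast_mul]
        rw [zsmul_eq_mul]
        ring) }
    ⟨fun v w h => periodVector_injective τ (congrArg Subtype.val h), fun z => by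
      obtain ⟨v, hv⟩ := exists_periodVector_eq (congrArg Subtype.val τ.2) z.2
      exact ⟨v, Subtype.ext hv⟩⟩

@[simp]
lemma coe_periodEquiv {l : legendreBase} (τ : lambdaMap ⁻¹' {l}) (v : ℤ × ℤ) :
    (periodEquiv τ v : ℂ) = periodVector (τ : ℍ) v := rfl

/-- The ratio of the two basis periods is `τ`. -/
lemma periodEquiv_injective {l : legendreBase} :
    Function.Injective (periodEquiv : lambdaMap ⁻¹' {l} → _) := by
  intro τ τ' h
  have h1 : periodVector (τ : ℍ) (1, 0) = periodVector (τ' : ℍ) (1, 0) :=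
    congrArg (fun e : (ℤ × ℤ) ≃ₗ[ℤ] periodLattice l => (e (1, 0) : ℂ)) h
  have h2 : periodVector (τ : ℍ) (0, 1) = periodVector (τ' : ℍ) (0, 1) :=
    congrArg (fun e : (ℤ × ℤ) ≃ₗ[ℤ] periodLattice l => (e (0, 1) : ℂ)) h
  simp only [periodVector, Int.cast_one, Int.cast_zero, zero_mul, add_zero, mul_one, zero_add,
    one_mul] at h1 h2
  rw [h1] at h2
  exact Subtype.ext (UpperHalfPlane.ext
    (mul_left_cancel₀ (periodScale_ne_zero (τ' : ℍ).im_pos) h2))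

section Representation

variable {B : Type*} [TopologicalSpace B] (p : C(B, legendreBase)) {b : B}

/-- The endpoint of the lift of the image of a loop to the upper half plane. -/
def liftEnd (a : FundamentalGroup B b) (τ : lambdaMap ⁻¹' {p b}) : lambdaMap ⁻¹' {p b} :=
  isQuotientCoveringMap_lambdaMap.isCoveringMap.monodromy (FundamentalGroup.map p b a) τ

lemma liftEnd_mul (a a' : FundamentalGroup B b) (τ : lambdaMap ⁻¹' {p b}) :
    liftEnd p (a * a') τ = liftEnd p a (liftEnd p a' τ) := by
  rw [liftEnd, map_mul, FundamentalGroup.mul_def]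
  exact IsCoveringMap.monodromy_trans_apply _ _ _ _

/-- The transport of periods along a loop, computed with a point of the upper half plane over the
base point. -/
def periodTransport (a : FundamentalGroup B b) (τ : lambdaMap ⁻¹' {p b}) :
    periodLattice (p b) ≃ₗ[ℤ] periodLattice (p b) :=
  (periodEquiv τ).symm.trans (periodEquiv (liftEnd p a τ))

lemma exists_lift (γ : Path b b) (τ : lambdaMap ⁻¹' {p b}) : ∃ ξ : C(I, ℍ),
    (∀ t, modularLambda (ξ t) = p (γ t)) ∧ ξ 0 = τ ∧
      ξ 1 = liftEnd p (FundamentalGroup.fromPath (Path.Homotopic.Quotient.mk γ)) τ := by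
  let cov := isQuotientCoveringMap_lambdaMap.isCoveringMap
  have h0 : (γ.map p.continuous) 0 = lambdaMap τ := (γ.map p.continuous).source.trans τ.2.symm
  refine ⟨cov.liftPath (γ.map p.continuous) τ h0, fun t => ?_, cov.liftPath_zero _ _ _, rfl⟩
  exact congrArg Subtype.val (congrFun (cov.liftPath_lifts (γ.map p.continuous) τ h0) t)

variable {p} [ChartedSpace ℂ B]

lemma IsPeriodContinuation.apply_one {γ : Path b b} {f : I → B → ℂ}
    (hf : IsPeriodContinuation p γ f) {w : periodLattice (p b)} (hw : f 0 b = w)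
    (τ : lambdaMap ⁻¹' {p b}) :
    f 1 b = periodTransport p (FundamentalGroup.fromPath (Path.Homotopic.Quotient.mk γ)) τ w := by
  obtain ⟨ξ, hξ, h0, h1⟩ := exists_lift p γ τ
  obtain ⟨v, hv⟩ := hf.exists_periodVector hξ
  have hv0 := hv 0
  have hv1 := hv 1
  rw [h0, γ.source, hw] at hv0
  rw [h1, γ.target] at hv1
  have : periodEquiv τ v = w := Subtype.ext hv0.symm
  rw [hv1, periodTransport, LinearEquiv.trans_apply, ← this, LinearEquiv.symm_apply_apply,
    coe_periodEquiv]

variable (hol : MDifferentiable 𝓘(ℂ) 𝓘(ℂ) (fun x => (p x : ℂ)))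
include hol

lemma exists_isPeriodContinuation_loop (γ : Path b b) (τ : lambdaMap ⁻¹' {p b})
    (w : periodLattice (p b)) : ∃ f : I → B → ℂ, IsPeriodContinuation p γ f ∧ f 0 b = w ∧
      f 1 b = periodTransport p
        (FundamentalGroup.fromPath (Path.Homotopic.Quotient.mk γ)) τ w := by
  obtain ⟨ξ, hξ, h0, -⟩ := exists_lift p γ τ
  obtain ⟨f, hf, hv⟩ := exists_isPeriodContinuation hol hξ ((periodEquiv τ).symm w)
  have hw : f 0 b = w := by
    have := hv 0
    rw [γ.source, h0, ← coe_periodEquiv, LinearEquiv.apply_symm_apply] at this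
    exact this
  exact ⟨f, hf, hw, hf.apply_one hw τ⟩

/-- The continuation constructed from one lift can be evaluated along any other lift. -/
lemma periodTransport_eq (a : FundamentalGroup B b) (τ τ' : lambdaMap ⁻¹' {p b}) :
    periodTransport p a τ = periodTransport p a τ' := by
  obtain ⟨γ, rfl⟩ := Path.Homotopic.Quotient.mk_surjective a
  ext w
  obtain ⟨f, hf, h0, h1⟩ := exists_isPeriodContinuation_loop hol γ τ w
  exact h1.symm.trans (hf.apply_one h0 τ')

/-- The monodromy representation on periods. -/
def periodMonodromy (τ : lambdaMap ⁻¹' {p b}) :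
    FundamentalGroup B b →* (periodLattice (p b) ≃ₗ[ℤ] periodLattice (p b)) where
  toFun a := periodTransport p a τ
  map_one' := by
    rw [periodTransport, liftEnd, map_one, FundamentalGroup.one_def, IsCoveringMap.monodromy_refl]
    exact LinearEquiv.symm_trans_self _
  map_mul' a a' := by
    -- The second loop is lifted from the endpoint of the first lift, so that the lifts concatenate.
    rw [periodTransport_eq hol a τ (liftEnd p a' τ)]
    refine LinearEquiv.ext fun w => ?_
    rw [LinearEquiv.mul_apply]
    simp only [periodTransport, LinearEquiv.trans_apply, LinearEquiv.symm_apply_apply]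
    rw [liftEnd_mul]

lemma isPeriodMonodromy_iff (τ : lambdaMap ⁻¹' {p b})
    {ρ : FundamentalGroup B b →* (periodLattice (p b) ≃ₗ[ℤ] periodLattice (p b))} :
    IsPeriodMonodromy p b ρ ↔ ρ = periodMonodromy hol τ := by
  constructor
  · intro h
    ext a w
    obtain ⟨γ, rfl⟩ := Path.Homotopic.Quotient.mk_surjective a
    obtain ⟨f, hf, h0, h1⟩ := h γ w
    exact h1.symm.trans (hf.apply_one h0 τ)
  · rintro rfl γ w
    exact exists_isPeriodContinuation_loop hol γ τ w

/-- Transport compares the bases attached to the two ends of the lift, and distinct points over `p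
b` have distinct bases. -/
lemma ker_periodMonodromy (τ : lambdaMap ⁻¹' {p b}) :
    (periodMonodromy hol τ).ker =
      ((isQuotientCoveringMap_lambdaMap.fundamentalGroupToMulOpposite τ).comp
        (FundamentalGroup.map p b)).ker := by
  ext a
  rw [MonoidHom.mem_ker, MonoidHom.mem_ker, MonoidHom.comp_apply,
    IsQuotientCoveringMap.fundamentalGroupToMulOpposite_eq_one_iff]
  change periodTransport p a τ = 1 ↔ liftEnd p a τ = τ
  constructor
  · intro h
    apply periodEquiv_injective
    ext v
    have := LinearEquiv.congr_fun h (periodEquiv τ v)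
    rw [periodTransport, LinearEquiv.trans_apply, LinearEquiv.symm_apply_apply] at this
    rw [this]
    rfl
  · intro h
    rw [periodTransport, h]
    exact LinearEquiv.symm_trans_self _

end Representation

end

/-! ### The kernel of the monodromy of the pullback to `B` -/

theorem theorem3p3 {B : Type*} [TopologicalSpace B] [T2Space B] [ConnectedSpace B]
    [ChartedSpace ℂ B] [IsManifold 𝓘(ℂ) ω B]
    -- `p` is a finite holomorphic map to `S` with finite branch locus
    (p : B → legendreBase)
    (hol : MDifferentiable 𝓘(ℂ) 𝓘(ℂ) (fun x => (p x : ℂ)))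
    (hproper : IsProperMap p)
    (hfin : ∀ z : legendreBase, (p ⁻¹' {z}).Finite)
    (hR : (branchLocus p).Finite)
    -- the base point of `B`, with image outside the branch locus
    (b : B) (hb : b ∈ puncturedSource p)
    -- generators of `π₁(S ∖ R, p b)`: small loops around `0`, around `1` and around the points of `R`
    (𝔞₀ 𝔞₁ : FundamentalGroup (puncturedBase p) (puncturedMap p hproper.continuous ⟨b, hb⟩))
    (𝔡 : branchLocus p →
      FundamentalGroup (puncturedBase p) (puncturedMap p hproper.continuous ⟨b, hb⟩))
    (h𝔞₀ : IsSmallLoopAround 0 𝔞₀)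
    (h𝔞₁ : IsSmallLoopAround 1 𝔞₁)
    (h𝔡 : ∀ r : branchLocus p, IsSmallLoopAround (r : ℂ) (𝔡 r))
    (hgen : Subgroup.closure ({𝔞₀, 𝔞₁} ∪ Set.range 𝔡) = ⊤) :
    (∃! ρ : FundamentalGroup B b →* (periodLattice (p b) ≃ₗ[ℤ] periodLattice (p b)),
      IsPeriodMonodromy p b ρ) ∧
    ∀ ρ : FundamentalGroup B b →* (periodLattice (p b) ≃ₗ[ℤ] periodLattice (p b)),
      IsPeriodMonodromy p b ρ →
        -- a loop in `B ∖ p⁻¹(R)` acts trivially on periods iff its image under `p` lies in `K`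
        ρ.ker.comap (FundamentalGroup.map (puncturedInclusion p) ⟨b, hb⟩) =
          (commutatorHull {𝔞₀, 𝔞₀⁻¹, 𝔞₁, 𝔞₁⁻¹} (Set.range 𝔡)).comap
            (FundamentalGroup.map (puncturedMap p hproper.continuous) ⟨b, hb⟩) ∧
        -- and the classes of these loops in `B` make up the whole kernel
        ρ.ker =
          ((commutatorHull {𝔞₀, 𝔞₀⁻¹, 𝔞₁, 𝔞₁⁻¹} (Set.range 𝔡)).comap
            (FundamentalGroup.map (puncturedMap p hproper.continuous) ⟨b, hb⟩)).map
              (FundamentalGroup.map (puncturedInclusion p) ⟨b, hb⟩) := by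
  let P : C(B, legendreBase) := ⟨p, hproper.continuous⟩
  obtain ⟨τ₀, hτ₀⟩ := surjective_lambdaMap (p b)
  let τ : lambdaMap ⁻¹' {P b} := ⟨τ₀, hτ₀⟩
  have hiff := fun ρ => isPeriodMonodromy_iff (p := P) (ρ := ρ) hol τ
  refine ⟨⟨periodMonodromy (p := P) hol τ, (hiff _).mpr rfl, fun ρ hρ => (hiff ρ).mp hρ⟩,
    fun ρ hρ => ?_⟩
  have hker : ρ.ker = _ := (congrArg MonoidHom.ker ((hiff ρ).mp hρ)).trans
    (ker_periodMonodromy (p := P) hol τ)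
  -- the analogous kernel on the punctured base
  let ι : C(puncturedBase p, legendreBase) := ⟨fun x => ⟨x, x.2.1⟩, by fun_prop⟩
  have hcompl : legendreBase \ puncturedBase p ⊆ branchLocus p := fun x hx =>
    not_not.mp fun h => hx.2 ⟨hx.1, h⟩
  have hX : ∀ d ∈ Set.range 𝔡, ∃ q ∈ legendreBase, IsSmallLoopAround q d := by
    rintro _ ⟨r, rfl⟩
    obtain ⟨x, -, hx⟩ := r.2
    exact ⟨r, hx ▸ (p x).2, h𝔡 r⟩
  have hK := ker_lambdaMonodromy ι (fun _ => rfl) τ Set.sdiff_subset (hR.subset hcompl).countable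
    hgen hX
  have hcomap : ρ.ker.comap (FundamentalGroup.map (puncturedInclusion p) ⟨b, hb⟩) =
      (commutatorHull {𝔞₀, 𝔞₀⁻¹, 𝔞₁, 𝔞₁⁻¹} (Set.range 𝔡)).comap
        (FundamentalGroup.map (puncturedMap p hproper.continuous) ⟨b, hb⟩) := by
    -- Both kernels are pulled back from the monodromy of `λ` on `π₁(S)`, and the two maps from `B ∖
    -- p⁻¹(R)` to `S` are equal.
    rw [hker, ← hK]
    ext a
    obtain ⟨γ, rfl⟩ := Path.Homotopic.Quotient.mk_surjective a
    exact Iff.rfl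
  refine ⟨hcomap, ?_⟩
  rw [← hcomap]
  -- A subgroup is the image of its preimage under the surjection `j_*`; surjectivity holds since
  -- `p⁻¹(R)` is a finite union of finite fibres.
  refine (Subgroup.map_comap_eq_self_of_surjective
    (f := FundamentalGroup.map (puncturedInclusion p) ⟨b, hb⟩) ?_ _).symm
  refine FundamentalGroup.map_surjective_of_countable_compl
    exists_isOpenEmbedding_of_chartedSpace ?_ (puncturedInclusion p) (fun _ => rfl) ⟨b, hb⟩
  have hpre : (puncturedSource p)ᶜ ⊆ ⋃ z ∈ ((↑) : legendreBase → ℂ) ⁻¹' branchLocus p, p ⁻¹' {z} := by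
    intro x hx
    rw [Set.mem_iUnion₂]
    exact ⟨p x, not_not.mp hx, rfl⟩
  exact (((hR.preimage Subtype.val_injective.injOn).biUnion fun z _ => hfin z).subset hpre).countable
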